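/- For real $q$ with $|q|<1$ let $q^{1/3}$ denote the real cube root, and let $$G(q)=\cfrac{q^{1/3}}{1+\cfrac{q+q^2}{1+\cfrac{q^2+q^4}{1+\cfrac{q^3+q^6}{1+\cdots}}}}$$ be Ramanujan's cubic continued fraction, that is, the limit of the convergents of this continued fraction. Then: (a) For every real $q$ with $|q|<1$ the continued fraction converges, and $$G(q)=q^{1/3}\prod_{j=1}^{\infty}\frac{(1-q^{6j-5})(1-q^{6j-1})}{(1-q^{6j-3})^2}.$$ (b) For every integer $k$ and all real $x_1,x_2$ with $x_1+x_2\neq 0$, $$\frac{2^k-x_1x_2}{x_1+x_2}=1\quad\Longleftrightarrow\quad (1+x_1)(1+x_2)=1+2^k.$$ (c) Let $\alpha,\beta>0$ be real. In each of the following four cases the values $x_1,x_2$ are well defined (no denominator vanishes), $x_1+x_2\ne 0$, and both equations in (b) hold: 1. $k=1$, $\alpha\beta=\pi^2$, $x_1=1/G(-e^{-\alpha})$, $x_2=1/G(-e^{-\beta})$, so that $$\left(1+\frac1{G(-e^{-\alpha})}\right)\left(1+\frac1{G(-e^{-\beta})}\right)=1+2;$$ 2. $k=-1$, $\alpha\beta=2\pi^2$,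 $x_1=G(e^{-\alpha})$, $x_2=G(e^{-\beta})$, so that $$\left(1+G(e^{-\alpha})\right)\left(1+G(e^{-\beta})\right)=1+\frac12;$$ 3. $k=3$, $\alpha\beta=\pi^2/3$, $x_1=1/G^3(-e^{-\alpha})$, $x_2=1/G^3(-e^{-\beta})$, so that $$\left(1+\frac1{G^3(-e^{-\alpha})}\right)\left(1+\frac1{G^3(-e^{-\beta})}\right)=1+2^3;$$ 4. $k=-3$, $\alpha\beta=2\pi^2/3$, $x_1=G^3(e^{-\alpha})$, $x_2=G^3(e^{-\beta})$, so that $$\left(1+G^3(e^{-\alpha})\right)\left(1+G^3(e^{-\beta})\right)=1+\frac1{2^3}.$$ -/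

import Mathlib

open Filter Topology

noncomputable section

/-- The real cube root of a real number; it is odd, so that `cubeRoot (-x) = -cubeRoot x`. -/
def cubeRoot (x : ℝ) : ℝ := Real.sign x * |x| ^ (1 / 3 : ℝ)

/-- The infinite continued fraction
`q^{1/3} / (1 + (q + q²) / (1 + (q² + q⁴) / (1 + (q³ + q⁶) / (1 + ⋯))))`. -/
def cubicContFract (q : ℝ) : GenContFract ℝ where
  h := 0
  s := Stream'.Seq.ofStream fun n : ℕ =>
    if n = 0 then ⟨cubeRoot q, 1⟩ else ⟨q ^ n + q ^ (2 * n), 1⟩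

/-- Ramanujan's cubic continued fraction `G(q)`: the limit of the convergents of
`cubicContFract q`. -/
def cubicG (q : ℝ) : ℝ := limUnder atTop fun n : ℕ => (cubicContFract q).convs n

/-- The `j`-th factor (counted from `j = 0`) of the product formula for `G(q)`. -/
def cubicFactor (q : ℝ) (j : ℕ) : ℝ :=
  (1 - q ^ (6 * j + 1)) * (1 - q ^ (6 * j + 5)) / (1 - q ^ (6 * j + 3)) ^ 2

/-- The two forms of the quadratic relation between `x₁` and `x₂` with parameter `k`;
`x₁ + x₂ ≠ 0` makes the quotient in the second form meaningful. -/
def CubicReciprocity (k : ℤ) (x₁ x₂ : ℝ) : Prop :=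
  (1 + x₁) * (1 + x₂) = 1 + (2 : ℝ) ^ k ∧
    x₁ + x₂ ≠ 0 ∧ ((2 : ℝ) ^ k - x₁ * x₂) / (x₁ + x₂) = 1

end

/-! Write E(q) = (q;q)_∞, φ(q) = f(q,q), 2ψ(q) = f(1,q), with f(a,b) = `ramTheta a b`.

Convergence and product. The well-poised series S(a) = `poisedSum q a` satisfies a second-order
q-difference equation. At a = q^m it says that F_m = S(q^m)(q;q)_m solves the recurrence adjoint to
that of the continuants. The pairing of the two solutions is constant (`tendsto_of_recurrence`), so
numerators and denominators converge separately and G(q) = q^{1/3} F_1/F_0. Here F_0 = S(1) = φ(-q³)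
and F_1 = (1-q)S(q) = f(-q,-q⁵), and Jacobi's triple product turns the quotient into the infinite
product.

Reciprocity. Put q = x³. The 3-dissections of φ(-x) and ψ(x) give 1 - 2G = φ(-x)/φ(-x⁹) and 1 + 1/G
= ψ(x)/(xψ(x⁹)). Multiplying the dissections over x, wx, w²x, with w a primitive cube root of unity,
gives 1 - 8G³ = (φ(-x³)/φ(-x⁹))⁴ and 1 + 1/G³ = ψ(x³)⁴/(x³ψ(x⁹)⁴). Poisson summation sends φ to φ
and φ(-·) to ψ under t ↦ const/t, so suitable products of two such quotients are the constants √9 =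
3 or (√3)⁴ = 9. The four formulas are rearrangements of these. -/

/-! ### Infinite q-products and their behaviour under cube roots of unity. -/

section QPochhammer

variable {𝕜 : Type*} [NormedField 𝕜]

theorem summable_norm_mul_pow (a : 𝕜) {q : 𝕜} (hq : ‖q‖ < 1) :
    Summable fun n : ℕ => ‖-(a * q ^ n)‖ := by
  simp only [norm_neg, norm_mul, norm_pow]
  exact (summable_geometric_of_lt_one (norm_nonneg q) hq).mul_left _

theorem one_sub_ne_zero_of_norm_lt {x : 𝕜} (hx : ‖x‖ < 1) : 1 - x ≠ 0 := by
  intro h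
  rw [← sub_eq_zero.1 h, norm_one] at hx
  exact lt_irrefl _ hx

theorem one_sub_mul_pow_ne_zero {a q : 𝕜} (ha : ‖a‖ < 1) (hq : ‖q‖ < 1) (n : ℕ) :
    1 - a * q ^ n ≠ 0 := by
  apply one_sub_ne_zero_of_norm_lt
  rw [norm_mul, norm_pow]
  exact (mul_le_of_le_one_right (norm_nonneg _)
    (pow_le_one₀ (norm_nonneg _) hq.le)).trans_lt ha

theorem norm_pow_lt_one {q : 𝕜} (hq : ‖q‖ < 1) {k : ℕ} (hk : k ≠ 0) : ‖q ^ k‖ < 1 := by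
  rw [norm_pow]; exact pow_lt_one₀ (norm_nonneg _) hq hk

theorem norm_eq_one_of_cubic {w : 𝕜} (hw : 1 + w + w ^ 2 = 0) : ‖w‖ = 1 := by
  have w3 : w ^ 3 = 1 := by linear_combination (w - 1) * hw
  have : ‖w‖ ^ 3 = 1 := by rw [← norm_pow, w3, norm_one]
  exact (pow_eq_one_iff_of_nonneg (norm_nonneg _) three_ne_zero).1 this

variable [CompleteSpace 𝕜]

/-- The infinite `q`-Pochhammer symbol `(a; q)_∞`. -/
noncomputable def qPoch (a q : 𝕜) : 𝕜 := ∏' n : ℕ, (1 - a * q ^ n)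

theorem multipliable_qPoch (a : 𝕜) {q : 𝕜} (hq : ‖q‖ < 1) :
    Multipliable fun n : ℕ => 1 - a * q ^ n := by
  simpa [sub_eq_add_neg] using multipliable_one_add_of_summable (summable_norm_mul_pow a hq)

theorem tendsto_qPoch (a : 𝕜) {q : 𝕜} (hq : ‖q‖ < 1) :
    Tendsto (fun N => ∏ n ∈ Finset.range N, (1 - a * q ^ n)) atTop (𝓝 (qPoch a q)) :=
  (multipliable_qPoch a hq).hasProd.tendsto_prod_nat

theorem qPoch_ne_zero {a q : 𝕜} (ha : ‖a‖ < 1) (hq : ‖q‖ < 1) : qPoch a q ≠ 0 := by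
  have := tprod_one_add_ne_zero_of_summable (f := fun n : ℕ => -(a * q ^ n))
    (fun n => by simpa [sub_eq_add_neg] using one_sub_mul_pow_ne_zero ha hq n)
    (summable_norm_mul_pow a hq)
  simpa [qPoch, sub_eq_add_neg] using this

theorem qPoch_mul_neg (a : 𝕜) {q : 𝕜} (hq : ‖q‖ < 1) :
    qPoch a q * qPoch (-a) q = qPoch (a ^ 2) (q ^ 2) := by
  rw [qPoch, qPoch, ← (multipliable_qPoch a hq).tprod_mul (multipliable_qPoch (-a) hq), qPoch]
  congr 1; ext n; ring

/-- Factor by factor this is (1-y)(1-wy)(1-w²y) = 1-y³, which needs only 1+w+w² = 0. -/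
theorem qPoch_mul_cubic {w : 𝕜} (hw : 1 + w + w ^ 2 = 0) (a : 𝕜) {q : 𝕜} (hq : ‖q‖ < 1) :
    qPoch a q * qPoch (w * a) q * qPoch (w ^ 2 * a) q = qPoch (a ^ 3) (q ^ 3) := by
  rw [qPoch, qPoch, qPoch,
    ← (multipliable_qPoch a hq).tprod_mul (multipliable_qPoch (w * a) hq),
    ← ((multipliable_qPoch a hq).mul (multipliable_qPoch (w * a) hq)).tprod_mul
      (multipliable_qPoch (w ^ 2 * a) hq), qPoch]
  congr 1; ext n
  linear_combination (-(a * q ^ n) + (a * q ^ n) ^ 2 * w - (a * q ^ n) ^ 3 * (w - 1)) * hw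

theorem qPoch_one_sub_mul (a : 𝕜) {q : 𝕜} (hq : ‖q‖ < 1) :
    qPoch a q = (1 - a) * qPoch (a * q) q := by
  have h1 := (tendsto_add_atTop_iff_nat 1).2 (tendsto_qPoch a hq)
  refine tendsto_nhds_unique h1 (((tendsto_qPoch (a * q) hq).const_mul (1 - a)).congr fun N => ?_)
  rw [Finset.prod_range_succ', mul_comm]
  congr 1
  · exact Finset.prod_congr rfl fun n _ => by ring
  · simp

/-- Splitting `(a; q)_∞` according to residue classes modulo `k`. -/
theorem qPoch_eq_prod (a : 𝕜) {q : 𝕜} (hq : ‖q‖ < 1) {k : ℕ} (hk : k ≠ 0) :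
    qPoch a q = ∏ r ∈ Finset.range k, qPoch (a * q ^ r) (q ^ k) := by
  have h1 := (tendsto_qPoch a hq).comp (tendsto_id.const_mul_atTop' (Nat.pos_of_ne_zero hk))
  refine tendsto_nhds_unique h1 ((tendsto_finsetProd (Finset.range k) fun r _ =>
    tendsto_qPoch (a * q ^ r) (norm_pow_lt_one hq hk)).congr fun N => ?_)
  simp only [Function.comp, id]
  rw [Finset.prod_comm]
  induction N with
  | zero => simp
  | succ N ih =>
    rw [Finset.prod_range_succ, ih, mul_add, mul_one, Finset.prod_range_add]
    congr 1
    exact Finset.prod_congr rfl fun r _ => by ring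

theorem qPoch_split_two (a : 𝕜) {q : 𝕜} (hq : ‖q‖ < 1) :
    qPoch a q = qPoch a (q ^ 2) * qPoch (a * q) (q ^ 2) := by
  rw [qPoch_eq_prod a hq two_ne_zero]; simp [Finset.prod_range_succ]

theorem qPoch_split_three (a : 𝕜) {q : 𝕜} (hq : ‖q‖ < 1) :
    qPoch a q = qPoch a (q ^ 3) * qPoch (a * q) (q ^ 3) * qPoch (a * q ^ 2) (q ^ 3) := by
  rw [qPoch_eq_prod a hq three_ne_zero]; simp [Finset.prod_range_succ]

/-- Euler's product `(q; q)_∞`. -/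
noncomputable def eulerProd (q : 𝕜) : 𝕜 := qPoch q q

theorem eulerProd_ne_zero {q : 𝕜} (hq : ‖q‖ < 1) : eulerProd q ≠ 0 := qPoch_ne_zero hq hq

theorem qPoch_neg_self {q : 𝕜} (hq : ‖q‖ < 1) :
    eulerProd q * qPoch (-q) q = eulerProd (q ^ 2) := qPoch_mul_neg q hq

theorem qPoch_odd {q : 𝕜} (hq : ‖q‖ < 1) :
    qPoch q (q ^ 2) * eulerProd (q ^ 2) = eulerProd q := by
  rw [eulerProd, eulerProd, qPoch_split_two q hq, sq]

/-- Split each product modulo 3. The three bases share the cube x³, so class 0 contributes E(x³)³,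
while classes 1 and 2 multiply to the matching classes of E(x³); the factor E(x⁹) supplies the
missing class. -/
theorem eulerProd_cubic {w : 𝕜} (hw : 1 + w + w ^ 2 = 0) {x : 𝕜} (hx : ‖x‖ < 1) :
    eulerProd x * eulerProd (w * x) * eulerProd (w ^ 2 * x) * eulerProd (x ^ 9) =
      eulerProd (x ^ 3) ^ 4 := by
  have w3 : w ^ 3 = 1 := by linear_combination (w - 1) * hw
  have hx3 : ‖x ^ 3‖ < 1 := norm_pow_lt_one hx three_ne_zero
  have nw := norm_eq_one_of_cubic hw
  have e (y : 𝕜) (hy : ‖y‖ < 1) (hyx : y ^ 3 = x ^ 3) :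
      eulerProd y = qPoch y (x ^ 3) * qPoch (y ^ 2) (x ^ 3) * eulerProd (x ^ 3) := by
    rw [eulerProd, qPoch_split_three y hy, hyx, eulerProd]
    congr 2
    · rw [sq]
    · rw [← hyx]; ring
  rw [e x hx rfl, e (w * x) (by simpa [nw]) (by rw [mul_pow, w3, one_mul]),
    e (w ^ 2 * x) (by simpa [nw]) (by linear_combination x ^ 3 * (w ^ 3 + 1) * w3)]
  have h1 := qPoch_mul_cubic hw x hx3
  have h2 := qPoch_mul_cubic hw (x ^ 2) hx3
  have h3 := qPoch_split_three (x ^ 3) hx3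
  have h4 : (w ^ 2 * x) ^ 2 = w * x ^ 2 := by linear_combination x ^ 2 * w * w3
  rw [h4, mul_pow w x 2]
  have h5 : eulerProd (x ^ 9) = qPoch (x ^ 3 * (x ^ 3) ^ 2) ((x ^ 3) ^ 3) := by
    rw [eulerProd]; congr 1 <;> ring
  rw [h5]
  have h6 : eulerProd (x ^ 3) = qPoch (x ^ 3) (x ^ 3) := rfl
  have h7 : (x ^ 2) ^ 3 = x ^ 3 * x ^ 3 := by ring
  rw [h7] at h2
  rw [← h6, ← h1, ← h2] at h3
  linear_combination (-eulerProd (x ^ 3) ^ 3) * h3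

end QPochhammer

/-! ### Ramanujan's theta function and Jacobi's triple product. -/

section TripleProduct

variable {𝕜 : Type*} [NormedField 𝕜]

/-- The general term of Ramanujan's theta series `f(a, b)`. -/
def thetaTerm (a b : 𝕜) (n : ℤ) : 𝕜 := a ^ (n * (n + 1) / 2) * b ^ (n * (n - 1) / 2)

/-- Ramanujan's general theta function `f(a, b) = ∑ a^{n(n+1)/2} b^{n(n-1)/2}`. -/
noncomputable def ramTheta (a b : 𝕜) : 𝕜 := ∑' n : ℤ, thetaTerm a b n

theorem thetaTerm_zero (a b : 𝕜) : thetaTerm a b 0 = 1 := by simp [thetaTerm]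

theorem thetaTerm_neg (a b : 𝕜) (n : ℤ) : thetaTerm a b (-n) = thetaTerm b a n := by
  rw [thetaTerm, thetaTerm, mul_comm]
  congr 3 <;> ring

theorem ramTheta_comm (a b : 𝕜) : ramTheta a b = ramTheta b a := by
  rw [ramTheta, ← (Equiv.neg ℤ).tsum_eq]
  simp only [Equiv.neg_apply, thetaTerm_neg, ramTheta]

theorem thetaTerm_succ {a b : 𝕜} (ha : a ≠ 0) (hb : b ≠ 0) (n : ℤ) :
    thetaTerm a b (n + 1) = thetaTerm a b n * (a * (a * b) ^ n) := by
  have h1 : (n + 1) * (n + 1 + 1) / 2 = n * (n + 1) / 2 + (n + 1) := by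
    rw [show (n + 1) * (n + 1 + 1) = n * (n + 1) + (n + 1) * 2 by ring,
      Int.add_mul_ediv_right _ _ two_ne_zero]
  have h2 : (n + 1) * (n + 1 - 1) / 2 = n * (n - 1) / 2 + n := by
    rw [show (n + 1) * (n + 1 - 1) = n * (n - 1) + n * 2 by ring,
      Int.add_mul_ediv_right _ _ two_ne_zero]
  rw [thetaTerm, thetaTerm, h1, h2, zpow_add₀ ha, zpow_add₀ hb, zpow_add_one₀ ha, mul_zpow]
  ring

theorem summable_thetaTerm_nat {a b : 𝕜} (ha : a ≠ 0) (hb : b ≠ 0) (hab : ‖a * b‖ < 1) :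
    Summable fun n : ℕ => ‖thetaTerm a b n‖ := by
  have hne (n : ℕ) : thetaTerm a b n ≠ 0 := mul_ne_zero (zpow_ne_zero _ ha) (zpow_ne_zero _ hb)
  refine summable_of_ratio_test_tendsto_lt_one (l := 0) one_pos
    (Eventually.of_forall fun n => norm_ne_zero_iff.2 (hne n)) ?_
  have h : Tendsto (fun n : ℕ => ‖a‖ * ‖a * b‖ ^ n) atTop (𝓝 (‖a‖ * 0)) :=
    (tendsto_pow_atTop_nhds_zero_of_lt_one (norm_nonneg _) hab).const_mul _
  rw [mul_zero] at h
  refine h.congr fun n => ?_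
  rw [norm_norm, norm_norm, Nat.cast_succ, thetaTerm_succ ha hb,
    norm_mul (thetaTerm a b n), mul_div_cancel_left₀ _ (norm_ne_zero_iff.2 (hne n)), zpow_natCast,
    norm_mul a ((a * b) ^ n), norm_pow]

theorem summable_norm_thetaTerm {a b : 𝕜} (ha : a ≠ 0) (hb : b ≠ 0) (hab : ‖a * b‖ < 1) :
    Summable fun n : ℤ => ‖thetaTerm a b n‖ := by
  refine Summable.of_nat_of_neg (summable_thetaTerm_nat ha hb hab) ?_
  simp only [thetaTerm_neg]
  exact summable_thetaTerm_nat hb ha (by rwa [mul_comm])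

/-- The finite product `(Q; Q)_k`. -/
def finPoch (Q : 𝕜) (k : ℕ) : 𝕜 := ∏ j ∈ Finset.range k, (1 - Q * Q ^ j)

theorem finPoch_succ (Q : 𝕜) (k : ℕ) :
    finPoch Q (k + 1) = finPoch Q k * (1 - Q ^ (k + 1)) := by
  rw [finPoch, Finset.prod_range_succ, finPoch, pow_succ']

theorem finPoch_ne_zero {Q : 𝕜} (hQ : ‖Q‖ < 1) (k : ℕ) : finPoch Q k ≠ 0 :=
  Finset.prod_ne_zero_iff.2 fun j _ => one_sub_mul_pow_ne_zero hQ hQ j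

/-- `1 / (Q; Q)_k`, extended by zero to negative `k`. -/
noncomputable def invPoch (Q : 𝕜) (k : ℤ) : 𝕜 := if 0 ≤ k then (finPoch Q k.toNat)⁻¹ else 0

/-- The zero convention makes this hold for every integer: at k = 0 the factor 1-Q^0 vanishes. The
induction below therefore has no boundary cases. -/
theorem one_sub_mul_invPoch {Q : 𝕜} (hQ : ‖Q‖ < 1) (k : ℤ) :
    (1 - Q ^ k) * invPoch Q k = invPoch Q (k - 1) := by
  rcases lt_trichotomy k 0 with h | rfl | h
  · rw [invPoch, invPoch, if_neg (by omega), if_neg (by omega), mul_zero]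
  · simp [invPoch]
  · obtain ⟨m, rfl⟩ : ∃ m : ℕ, k = m + 1 := ⟨(k - 1).toNat, by omega⟩
    rw [invPoch, invPoch, if_pos (by omega), if_pos (by omega), add_sub_cancel_right,
      show ((m : ℤ) + 1).toNat = m + 1 by omega, Int.toNat_natCast, finPoch_succ]
    have h1 := finPoch_ne_zero hQ m
    have h2 := finPoch_ne_zero hQ (m + 1)
    rw [finPoch_succ] at h2
    have h3 := right_ne_zero_of_mul h2
    rw [show Q ^ ((m : ℤ) + 1) = Q ^ (m + 1) from by exact_mod_cast zpow_natCast Q (m + 1)]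
    field_simp

/-- The finite form of the triple product identity. -/
theorem hasSum_finite_triple {a b : 𝕜} (ha : a ≠ 0) (hb : b ≠ 0) (hab : ‖a * b‖ < 1) (N : ℕ) :
    HasSum (fun n : ℤ => finPoch (a * b) (2 * N) * invPoch (a * b) (N + n) *
        invPoch (a * b) (N - n) * thetaTerm a b n)
      (∏ j ∈ Finset.range N, ((1 + a * (a * b) ^ j) * (1 + b * (a * b) ^ j))) := by
  induction N with
  | zero =>
    convert hasSum_single (0 : ℤ) ?_ using 1
    · simp [finPoch, invPoch, thetaTerm]
    · intro n hn
      rcases lt_or_gt_of_ne hn with h | h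
      · simp [invPoch, not_le.2 h]
      · simp [invPoch, not_le.2 h]
  | succ N ih =>
    set Q := a * b with hQ
    have hQ0 : Q ≠ 0 := mul_ne_zero ha hb
    -- The new factor (1+aQ^N)(1+bQ^N) expands to (1+Q^{2N+1}) + aQ^N + bQ^N. The linear terms are
    -- absorbed by shifting the index by one, down for a and up for b.
    have s1 := ((Equiv.addRight (-1 : ℤ)).hasSum_iff.2 ih).mul_left (a * Q ^ N)
    have s2 := ((Equiv.addRight (1 : ℤ)).hasSum_iff.2 ih).mul_left (b * Q ^ N)
    have s0 := ih.mul_left (1 + Q ^ (2 * N + 1))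
    convert! (s0.add s1).add s2 using 1
    · ext n
      simp only [Function.comp, Equiv.coe_addRight]
      have t1 : a * thetaTerm a b (n + -1) = thetaTerm a b n * Q ^ (1 - n) := by
        have h := thetaTerm_succ ha hb (n + -1)
        rw [neg_add_cancel_right, ← hQ] at h
        rw [h, show 1 - n = -(n + -1) by ring, zpow_neg]
        have := zpow_ne_zero (n + -1) hQ0
        field_simp
      have t2 : b * thetaTerm a b (n + 1) = thetaTerm a b n * Q ^ (1 + n) := by
        rw [thetaTerm_succ ha hb, ← hQ, zpow_add₀ hQ0, zpow_one, hQ]; ring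
      have i1 := one_sub_mul_invPoch hab (N + 1 + n)
      have i2 := one_sub_mul_invPoch hab (N + n)
      have i3 := one_sub_mul_invPoch hab (N + 1 - n)
      have i4 := one_sub_mul_invPoch hab (N - n)
      rw [show (N : ℤ) + 1 + n - 1 = N + n by ring] at i1
      rw [show (N : ℤ) + 1 - n - 1 = N - n by ring] at i3
      have e1 : Q ^ ((N : ℤ) + 1 + n) = Q * Q ^ ((N : ℤ) + n) := by
        rw [← zpow_one_add₀ hQ0]; congr 1; ring
      have e2 : Q ^ ((N : ℤ) + 1 - n) = Q * Q ^ ((N : ℤ) - n) := by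
        rw [← zpow_one_add₀ hQ0]; congr 1; ring
      have e3 : Q ^ N * Q ^ (1 - n) = Q * Q ^ ((N : ℤ) - n) := by
        rw [← e2, ← zpow_natCast, ← zpow_add₀ hQ0]; congr 1; ring
      have e4 : Q ^ N * Q ^ (1 + n) = Q * Q ^ ((N : ℤ) + n) := by
        rw [← e1, ← zpow_natCast, ← zpow_add₀ hQ0]; congr 1; ring
      have e5 : Q ^ ((N : ℤ) + n) * Q ^ ((N : ℤ) - n) = Q ^ (2 * N) := by
        rw [← zpow_add₀ hQ0, ← zpow_natCast]; congr 1; push_cast; ring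
      have f1 : finPoch Q (2 * (N + 1)) =
          finPoch Q (2 * N) * (1 - Q * Q ^ (2 * N)) * (1 - Q * (Q * Q ^ (2 * N))) := by
        rw [show 2 * (N + 1) = 2 * N + 1 + 1 by ring, finPoch_succ, finPoch_succ]
        ring
      rw [f1, pow_succ', ← e5]
      push_cast
      rw [show (N : ℤ) + (n + -1) = N + n - 1 by ring, show (N : ℤ) - (n + -1) = N + 1 - n by ring,
        show (N : ℤ) + (n + 1) = N + 1 + n by ring, show (N : ℤ) - (n + 1) = N - n - 1 by ring,
        ← i2, ← i4, ← i1, ← i3, e1, e2]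
      set u := invPoch Q ((N : ℤ) + 1 + n)
      set v := invPoch Q ((N : ℤ) + 1 - n)
      set A := Q ^ ((N : ℤ) + n)
      set B := Q ^ ((N : ℤ) - n)
      set D := finPoch Q (2 * N)
      set t := thetaTerm a b n
      linear_combination (-(Q ^ N * D * ((1 - A) * ((1 - Q * A) * u)) * v)) * t1 -
        (Q ^ N * D * u * ((1 - B) * ((1 - Q * B) * v))) * t2 -
        (t * D * ((1 - A) * ((1 - Q * A) * u)) * v) * e3 -
        (t * D * u * ((1 - B) * ((1 - Q * B) * v))) * e4
    · rw [Finset.prod_range_succ, pow_succ', hQ]; ring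

variable [CompleteSpace 𝕜]

theorem tendsto_finPoch {Q : 𝕜} (hQ : ‖Q‖ < 1) :
    Tendsto (finPoch Q) atTop (𝓝 (eulerProd Q)) := tendsto_qPoch Q hQ

theorem tendsto_invPoch {Q : 𝕜} (hQ : ‖Q‖ < 1) :
    Tendsto (invPoch Q) atTop (𝓝 (eulerProd Q)⁻¹) := by
  have h0 : Tendsto Int.toNat atTop atTop :=
    tendsto_atTop_atTop.2 fun n => ⟨n, fun k hk => by omega⟩
  have h1 : Tendsto (fun k : ℤ => (finPoch Q k.toNat)⁻¹) atTop (𝓝 (eulerProd Q)⁻¹) :=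
    ((tendsto_finPoch hQ).comp h0).inv₀ (eulerProd_ne_zero hQ)
  refine h1.congr' ?_
  filter_upwards [eventually_ge_atTop 0] with k hk
  rw [invPoch, if_pos hk]

theorem exists_bound_finPoch {Q : 𝕜} (hQ : ‖Q‖ < 1) : ∃ C, ∀ k, ‖finPoch Q k‖ ≤ C := by
  obtain ⟨C, hC⟩ := (tendsto_finPoch hQ).norm.bddAbove_range
  exact ⟨C, fun k => hC ⟨k, rfl⟩⟩

theorem exists_bound_invPoch {Q : 𝕜} (hQ : ‖Q‖ < 1) : ∃ C, 0 ≤ C ∧ ∀ k, ‖invPoch Q k‖ ≤ C := by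
  obtain ⟨C, hC⟩ := ((tendsto_finPoch hQ).inv₀ (eulerProd_ne_zero hQ)).norm.bddAbove_range
  have hC0 : 0 ≤ C := (norm_nonneg _).trans (hC ⟨0, rfl⟩)
  refine ⟨C, hC0, fun k => ?_⟩
  rw [invPoch]
  split_ifs
  · exact hC ⟨k.toNat, rfl⟩
  · simpa

/-- **Jacobi's triple product identity.** -/
theorem ramTheta_eq_prod {a b : 𝕜} (ha : a ≠ 0) (hb : b ≠ 0) (hab : ‖a * b‖ < 1) :
    ramTheta a b = qPoch (-a) (a * b) * qPoch (-b) (a * b) * eulerProd (a * b) := by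
  obtain ⟨C, hC⟩ := exists_bound_finPoch hab
  obtain ⟨D, hD0, hD⟩ := exists_bound_invPoch hab
  have hC0 : 0 ≤ C := (norm_nonneg _).trans (hC 0)
  have hE := eulerProd_ne_zero hab
  -- Let N → ∞ in the finite identity: each coefficient tends to E·E⁻¹·E⁻¹ and is bounded uniformly
  -- in N and n, so dominated convergence applies.
  have lim : Tendsto (fun N : ℕ => ∑' n : ℤ, finPoch (a * b) (2 * N) * invPoch (a * b) (N + n) *
        invPoch (a * b) (N - n) * thetaTerm a b n) atTop
      (𝓝 (∑' n : ℤ, eulerProd (a * b) * (eulerProd (a * b))⁻¹ * (eulerProd (a * b))⁻¹ *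
        thetaTerm a b n)) := by
    refine tendsto_tsum_of_dominated_convergence
      (bound := fun n => C * D * D * ‖thetaTerm a b n‖)
      ((summable_norm_thetaTerm ha hb hab).mul_left _) (fun n => ?_)
      (Eventually.of_forall fun N n => ?_)
    · refine Tendsto.mul (Tendsto.mul (Tendsto.mul ?_ ?_) ?_) tendsto_const_nhds
      · exact (tendsto_finPoch hab).comp (tendsto_id.const_mul_atTop' two_pos)
      · exact (tendsto_invPoch hab).comp
          (tendsto_atTop_add_const_right _ n tendsto_natCast_atTop_atTop)
      · exact (tendsto_invPoch hab).comp
          (tendsto_atTop_add_const_right _ (-n) tendsto_natCast_atTop_atTop)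
    · rw [norm_mul, norm_mul, norm_mul]
      gcongr
      exacts [hC _, hD _, hD _]
  have lim2 : Tendsto (fun N => ∏ j ∈ Finset.range N,
      ((1 + a * (a * b) ^ j) * (1 + b * (a * b) ^ j))) atTop
      (𝓝 (qPoch (-a) (a * b) * qPoch (-b) (a * b))) := by
    refine ((tendsto_qPoch (-a) hab).mul (tendsto_qPoch (-b) hab)).congr fun N => ?_
    rw [← Finset.prod_mul_distrib]
    exact Finset.prod_congr rfl fun j _ => by ring
  have key := tendsto_nhds_unique lim (lim2.congr fun N =>
    (hasSum_finite_triple ha hb hab N).tsum_eq.symm)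
  rw [mul_inv_cancel₀ hE, one_mul, tsum_mul_left] at key
  rw [ramTheta, ← key]
  field_simp

end TripleProduct

/-! ### Dissections and eta-quotient identities for theta functions. -/

section ThetaIdentities

variable {𝕜 : Type*} [NormedField 𝕜]

theorem tsum_int_eq_sum_residues [CompleteSpace 𝕜] {f : ℤ → 𝕜} (hf : Summable f) (k : ℕ)
    [NeZero k] : ∑' n, f n = ∑ r : Fin k, ∑' m : ℤ, f (m * k + (r : ℕ)) := by
  have hs : Summable fun p : ℤ × Fin k => f (p.1 * k + (p.2 : ℕ)) :=
    (Int.divModEquiv k).symm.summable_iff.2 hf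
  rw [← (Int.divModEquiv k).symm.tsum_eq]
  simp only [Int.divModEquiv_symm_apply]
  rw [← (Equiv.prodComm (Fin k) ℤ).tsum_eq]
  exact ((Equiv.prodComm (Fin k) ℤ).summable_iff.2 hs).tsum_prod.trans (tsum_fintype _)

/-- Replaces integer division by a witness T, so that exponent identities become linear in T and n.
-/
theorem thetaTerm_eq_zpow (a b : 𝕜) {n T : ℤ} (h : n * (n + 1) = 2 * T) :
    thetaTerm a b n = a ^ T * b ^ (T - n) := by
  rw [thetaTerm, h, show n * (n - 1) = 2 * (T - n) by linear_combination h,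
    Int.mul_ediv_cancel_left _ two_ne_zero, Int.mul_ediv_cancel_left _ two_ne_zero]

theorem exists_half_mul_succ (n : ℤ) : ∃ T : ℤ, n * (n + 1) = 2 * T :=
  (even_iff_two_dvd.1 (Int.even_mul_succ_self n))

theorem mul_pow_zpow (a b : 𝕜) (i j : ℕ) (T : ℤ) :
    (a ^ i * b ^ j) ^ T = a ^ (i * T) * b ^ (j * T) := by
  rw [mul_zpow, ← zpow_natCast, ← zpow_natCast, ← zpow_mul, ← zpow_mul]

theorem thetaTerm_three_mul {a b : 𝕜} (ha : a ≠ 0) (hb : b ≠ 0) (m : ℤ) :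
    thetaTerm a b (3 * m) = thetaTerm (a ^ 6 * b ^ 3) (a ^ 3 * b ^ 6) m := by
  obtain ⟨T, hT⟩ := exists_half_mul_succ m
  rw [thetaTerm_eq_zpow _ _ hT, thetaTerm_eq_zpow (T := 9 * T - 3 * m) _ _
    (by linear_combination 9 * hT), mul_pow_zpow, mul_pow_zpow,
    mul_mul_mul_comm, ← zpow_add₀ ha, ← zpow_add₀ hb]
  congr 2 <;> push_cast <;> ring

/-- The factor a^0 is kept so that `mul_pow_zpow` applies to both arguments. -/
theorem thetaTerm_three_mul_add_one {a b : 𝕜} (ha : a ≠ 0) (hb : b ≠ 0) (m : ℤ) :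
    thetaTerm a b (3 * m + 1) = a * thetaTerm (a ^ 9 * b ^ 6) (a ^ 0 * b ^ 3) m := by
  obtain ⟨T, hT⟩ := exists_half_mul_succ m
  rw [thetaTerm_eq_zpow _ _ hT, thetaTerm_eq_zpow (T := 9 * T + 1) _ _
    (by linear_combination 9 * hT), mul_pow_zpow, mul_pow_zpow,
    mul_mul_mul_comm, ← zpow_add₀ ha, ← zpow_add₀ hb, ← mul_assoc, ← zpow_one_add₀ ha]
  congr 2 <;> push_cast <;> ring

variable [CompleteSpace 𝕜]

theorem summable_thetaTerm {a b : 𝕜} (ha : a ≠ 0) (hb : b ≠ 0) (hab : ‖a * b‖ < 1) :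
    Summable (thetaTerm a b) := (summable_norm_thetaTerm ha hb hab).of_norm

/-- The 3-dissection of the general theta function. -/
theorem ramTheta_three_dissection {a b : 𝕜} (ha : a ≠ 0) (hb : b ≠ 0) (hab : ‖a * b‖ < 1) :
    ramTheta a b = ramTheta (a ^ 6 * b ^ 3) (a ^ 3 * b ^ 6) + a * ramTheta (a ^ 9 * b ^ 6) (b ^ 3) +
      b * ramTheta (b ^ 9 * a ^ 6) (a ^ 3) := by
  rw [ramTheta, tsum_int_eq_sum_residues (summable_thetaTerm ha hb hab) 3, Fin.sum_univ_three]
  congr 1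
  · congr 1
    · rw [ramTheta]
      refine tsum_congr fun m => ?_
      rw [← thetaTerm_three_mul ha hb]; congr 1; simp; ring
    · rw [ramTheta, ← tsum_mul_left]
      refine tsum_congr fun m => ?_
      rw [← one_mul (b ^ 3), ← pow_zero a, ← thetaTerm_three_mul_add_one ha hb]
      congr 1; simp; ring
  -- Under m ↦ -(m+1) the index 3m+2 becomes -(3m+1), and negating the index swaps a and b: class 2
  -- is class 1 with the arguments exchanged.
  · rw [ramTheta, ← tsum_mul_left, ← (Equiv.neg ℤ).tsum_eq, ← (Equiv.addRight (1 : ℤ)).tsum_eq]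
    refine tsum_congr fun m => ?_
    rw [← one_mul (a ^ 3), ← pow_zero b, ← thetaTerm_three_mul_add_one hb ha, ← thetaTerm_neg]
    congr 1
    simp only [Equiv.neg_apply, Equiv.coe_addRight, Fin.val_two]
    push_cast
    ring

/-! Product formulas for `φ(-y) = f(-y, -y)`, `2 ψ(y) = f(1, y)`, `f(q, q²)`, `f(-q, -q⁵)`. -/

theorem ramTheta_neg_self_mul {y : 𝕜} (h0 : y ≠ 0) (hy : ‖y‖ < 1) :
    ramTheta (-y) (-y) * eulerProd (y ^ 2) = eulerProd y ^ 2 := by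
  have h2 : ‖y ^ 2‖ < 1 := norm_pow_lt_one hy two_ne_zero
  have e : -y * -y = y ^ 2 := by ring
  rw [ramTheta_eq_prod (neg_ne_zero.2 h0) (neg_ne_zero.2 h0) (by rwa [e]), e, neg_neg,
    ← qPoch_odd hy]
  ring

theorem ramTheta_one_mul {y : 𝕜} (h0 : y ≠ 0) (hy : ‖y‖ < 1) :
    ramTheta 1 y * eulerProd y = 2 * eulerProd (y ^ 2) ^ 2 := by
  rw [ramTheta_eq_prod one_ne_zero h0 (by rwa [one_mul]), one_mul, ← qPoch_neg_self hy,
    qPoch_one_sub_mul (-1) hy, neg_one_mul]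
  ring

theorem ramTheta_sq_mul {q : 𝕜} (h0 : q ≠ 0) (hq : ‖q‖ < 1) :
    ramTheta q (q ^ 2) * (eulerProd q * eulerProd (q ^ 6)) =
      eulerProd (q ^ 2) * eulerProd (q ^ 3) ^ 2 := by
  have h3 : ‖q ^ 3‖ < 1 := norm_pow_lt_one hq three_ne_zero
  have e : q * q ^ 2 = q ^ 3 := by ring
  have d := qPoch_split_three (-q) hq
  rw [show -q * q = -q ^ 2 by ring, show -q * q ^ 2 = -q ^ 3 by ring] at d
  have e6 := qPoch_neg_self h3
  rw [← pow_mul] at e6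
  rw [ramTheta_eq_prod h0 (pow_ne_zero 2 h0) (by rwa [e]), e, ← qPoch_neg_self hq, d, ← e6]
  ring

theorem ramTheta_neg_five_mul {q : 𝕜} (h0 : q ≠ 0) (hq : ‖q‖ < 1) :
    ramTheta (-q) (-q ^ 5) * (eulerProd (q ^ 2) * eulerProd (q ^ 3)) =
      eulerProd q * eulerProd (q ^ 6) ^ 2 := by
  have h2 : ‖q ^ 2‖ < 1 := norm_pow_lt_one hq two_ne_zero
  have h3 : ‖q ^ 3‖ < 1 := norm_pow_lt_one hq three_ne_zero
  have h6 : ‖q ^ 6‖ < 1 := norm_pow_lt_one hq (by norm_num)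
  have e : -q * -q ^ 5 = q ^ 6 := by ring
  have d := qPoch_split_three q h2
  rw [← pow_mul, show q * q ^ 2 = q ^ 3 by ring, show q * (q ^ 2) ^ 2 = q ^ 5 by ring] at d
  have e3 := qPoch_odd h3
  rw [← pow_mul] at e3
  rw [ramTheta_eq_prod (neg_ne_zero.2 h0) (neg_ne_zero.2 (pow_ne_zero 5 h0)) (by rwa [e]), e,
    neg_neg, neg_neg, ← qPoch_odd hq, d, ← e3]
  ring

theorem ramTheta_neg_self_ne_zero {y : 𝕜} (h0 : y ≠ 0) (hy : ‖y‖ < 1) :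
    ramTheta (-y) (-y) ≠ 0 := by
  intro h
  have := ramTheta_neg_self_mul h0 hy
  rw [h, zero_mul] at this
  exact pow_ne_zero 2 (eulerProd_ne_zero hy) this.symm

theorem ramTheta_neg_five_ne_zero {q : 𝕜} (h0 : q ≠ 0) (hq : ‖q‖ < 1) :
    ramTheta (-q) (-q ^ 5) ≠ 0 := by
  intro h
  have := ramTheta_neg_five_mul h0 hq
  rw [h, zero_mul] at this
  exact mul_ne_zero (eulerProd_ne_zero hq)
    (pow_ne_zero 2 (eulerProd_ne_zero (norm_pow_lt_one hq (by norm_num)))) this.symm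

/-- Both sides are the eta quotient 2E(q³)E(q⁶). This links the φ-expression of G to a ψ-expression.
-/
theorem ramTheta_mul_relation {q : 𝕜} (h0 : q ≠ 0) (hq : ‖q‖ < 1) :
    2 * (ramTheta q (q ^ 2) * ramTheta (-q) (-q ^ 5)) =
      ramTheta (-q ^ 3) (-q ^ 3) * ramTheta 1 (q ^ 3) := by
  have n1 := eulerProd_ne_zero hq
  have n2 := eulerProd_ne_zero (norm_pow_lt_one hq two_ne_zero)
  have h3 : ‖q ^ 3‖ < 1 := norm_pow_lt_one hq three_ne_zero
  have n3 := eulerProd_ne_zero h3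
  have n6 := eulerProd_ne_zero (norm_pow_lt_one hq (show 6 ≠ 0 by norm_num))
  have a1 := ramTheta_sq_mul h0 hq
  have a2 := ramTheta_neg_five_mul h0 hq
  have a3 := ramTheta_neg_self_mul (pow_ne_zero 3 h0) h3
  have a4 := ramTheta_one_mul (pow_ne_zero 3 h0) h3
  rw [← pow_mul] at a3 a4
  rw [← eq_div_iff (mul_ne_zero n1 n6)] at a1
  rw [← eq_div_iff (mul_ne_zero n2 n3)] at a2
  rw [← eq_div_iff n6] at a3
  rw [← eq_div_iff n3] at a4
  rw [a1, a2, a3, a4]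
  field_simp

theorem ramTheta_neg_self_dissection {x : 𝕜} (h0 : x ≠ 0) (hx : ‖x‖ < 1) :
    ramTheta (-x) (-x) =
      ramTheta (-x ^ 9) (-x ^ 9) - 2 * x * ramTheta (-x ^ 3) (-x ^ 15) := by
  have e : -x * -x = x ^ 2 := by ring
  rw [ramTheta_three_dissection (neg_ne_zero.2 h0) (neg_ne_zero.2 h0)
    (by rw [e]; exact norm_pow_lt_one hx two_ne_zero), ramTheta_comm (-x ^ 3)]
  rw [show (-x) ^ 6 * (-x) ^ 3 = -x ^ 9 by ring, show (-x) ^ 3 * (-x) ^ 6 = -x ^ 9 by ring,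
    show (-x) ^ 9 * (-x) ^ 6 = -x ^ 15 by ring, show (-x) ^ 3 = -x ^ 3 by ring]
  ring

theorem ramTheta_one_dissection {x : 𝕜} (h0 : x ≠ 0) (hx : ‖x‖ < 1) :
    ramTheta 1 x = 2 * ramTheta (x ^ 3) (x ^ 6) + x * ramTheta 1 (x ^ 9) := by
  rw [ramTheta_three_dissection one_ne_zero h0 (by rwa [one_mul]), ramTheta_comm 1 (x ^ 9)]
  simp only [one_pow, one_mul, mul_one]
  rw [ramTheta_comm (x ^ 6)]
  ring

theorem eulerProd_sq_cubic {w : 𝕜} (hw : 1 + w + w ^ 2 = 0) {x : 𝕜} (hx : ‖x‖ < 1) :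
    eulerProd (x ^ 2) * eulerProd ((w * x) ^ 2) * eulerProd ((w ^ 2 * x) ^ 2) *
      eulerProd ((x ^ 9) ^ 2) = eulerProd ((x ^ 3) ^ 2) ^ 4 := by
  have w3 : w ^ 3 = 1 := by linear_combination (w - 1) * hw
  have h := eulerProd_cubic hw (norm_pow_lt_one hx two_ne_zero)
  rw [show (w * x) ^ 2 = w ^ 2 * x ^ 2 by ring,
    show (w ^ 2 * x) ^ 2 = w * x ^ 2 by linear_combination x ^ 2 * w * w3,
    ← pow_mul, ← pow_mul, mul_comm 9, mul_comm 3, pow_mul x 2, pow_mul x 2, ← h]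
  ring

/-- The product over the cube roots of unity of the dissection of `φ(-x)`. -/
theorem ramTheta_neg_self_quartic {w : 𝕜} (hw : 1 + w + w ^ 2 = 0) {x : 𝕜} (h0 : x ≠ 0)
    (hx : ‖x‖ < 1) :
    (ramTheta (-x ^ 9) (-x ^ 9) ^ 3 - 8 * x ^ 3 * ramTheta (-x ^ 3) (-x ^ 15) ^ 3) *
      ramTheta (-x ^ 9) (-x ^ 9) = ramTheta (-x ^ 3) (-x ^ 3) ^ 4 := by
  have w3 : w ^ 3 = 1 := by linear_combination (w - 1) * hw
  have nw := norm_eq_one_of_cubic hw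
  have hw0 : w ≠ 0 := by rintro rfl; simp at hw
  have hx1 : ‖w * x‖ < 1 := by simpa [nw]
  have hx2 : ‖w ^ 2 * x‖ < 1 := by simpa [nw]
  have h1 : w * x ≠ 0 := mul_ne_zero hw0 h0
  have h2 : w ^ 2 * x ≠ 0 := mul_ne_zero (pow_ne_zero 2 hw0) h0
  have h3 : ‖x ^ 3‖ < 1 := norm_pow_lt_one hx three_ne_zero
  have h9 : ‖x ^ 9‖ < 1 := norm_pow_lt_one hx (by norm_num)
  have c1 : (w * x) ^ 3 = x ^ 3 := by linear_combination x ^ 3 * w3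
  have c2 : (w ^ 2 * x) ^ 3 = x ^ 3 := by linear_combination x ^ 3 * (w ^ 3 + 1) * w3
  have d0 := ramTheta_neg_self_dissection h0 hx
  have d1 := ramTheta_neg_self_dissection h1 hx1
  have d2 := ramTheta_neg_self_dissection h2 hx2
  -- Only powers of y³ occur in the two components, so they are the same for x, wx and w²x.
  have p9 (y : 𝕜) : y ^ 9 = (y ^ 3) ^ 3 := by ring
  have p15 (y : 𝕜) : y ^ 15 = (y ^ 3) ^ 5 := by ring
  rw [p9, p15, c1, ← p9, ← p15] at d1
  rw [p9, p15, c2, ← p9, ← p15] at d2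
  have m0 := ramTheta_neg_self_mul h0 hx
  have m1 := ramTheta_neg_self_mul h1 hx1
  have m2 := ramTheta_neg_self_mul h2 hx2
  have m3 := ramTheta_neg_self_mul (pow_ne_zero 3 h0) h3
  have m9 := ramTheta_neg_self_mul (pow_ne_zero 9 h0) h9
  have k1 := eulerProd_cubic hw hx
  have k2 := eulerProd_sq_cubic hw hx
  have n (y : 𝕜) (hy : ‖y‖ < 1) : eulerProd (y ^ 2) ≠ 0 :=
    eulerProd_ne_zero (norm_pow_lt_one hy two_ne_zero)
  -- A³ - (2xB)³ factors over the cube roots of unity, and each factor is a dissected φ.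
  have prod : ramTheta (-x ^ 9) (-x ^ 9) ^ 3 - 8 * x ^ 3 * ramTheta (-x ^ 3) (-x ^ 15) ^ 3 =
      ramTheta (-x) (-x) * ramTheta (-(w * x)) (-(w * x)) *
        ramTheta (-(w ^ 2 * x)) (-(w ^ 2 * x)) := by
    rw [d0, d1, d2]
    generalize ramTheta (-x ^ 9) (-x ^ 9) = A
    generalize ramTheta (-x ^ 3) (-x ^ 15) = B
    linear_combination (2 * A ^ 2 * x * B - 4 * A * x ^ 2 * B ^ 2 * w +
      8 * x ^ 3 * B ^ 3 * (w - 1)) * hw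
  rw [prod]
  rw [← eq_div_iff (n _ hx)] at m0
  rw [← eq_div_iff (n _ hx1)] at m1
  rw [← eq_div_iff (n _ hx2)] at m2
  rw [← eq_div_iff (n _ h3)] at m3
  rw [← eq_div_iff (n _ h9)] at m9
  rw [m0, m1, m2, m3, m9, div_pow, ← k2, pow_right_comm (eulerProd (x ^ 3)) 2 4, ← k1]
  have := n _ hx; have := n _ hx1; have := n _ hx2; have := n _ h9
  field_simp

/-- The product over the cube roots of unity of the dissection of `ψ(x)`. -/
theorem ramTheta_one_quartic {w : 𝕜} (hw : 1 + w + w ^ 2 = 0) {x : 𝕜} (h0 : x ≠ 0)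
    (hx : ‖x‖ < 1) :
    (8 * ramTheta (x ^ 3) (x ^ 6) ^ 3 + x ^ 3 * ramTheta 1 (x ^ 9) ^ 3) * ramTheta 1 (x ^ 9) =
      ramTheta 1 (x ^ 3) ^ 4 := by
  have w3 : w ^ 3 = 1 := by linear_combination (w - 1) * hw
  have nw := norm_eq_one_of_cubic hw
  have hw0 : w ≠ 0 := by rintro rfl; simp at hw
  have hx1 : ‖w * x‖ < 1 := by simpa [nw]
  have hx2 : ‖w ^ 2 * x‖ < 1 := by simpa [nw]
  have h1 : w * x ≠ 0 := mul_ne_zero hw0 h0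
  have h2 : w ^ 2 * x ≠ 0 := mul_ne_zero (pow_ne_zero 2 hw0) h0
  have h3 : ‖x ^ 3‖ < 1 := norm_pow_lt_one hx three_ne_zero
  have h9 : ‖x ^ 9‖ < 1 := norm_pow_lt_one hx (by norm_num)
  have c1 : (w * x) ^ 3 = x ^ 3 := by linear_combination x ^ 3 * w3
  have c2 : (w ^ 2 * x) ^ 3 = x ^ 3 := by linear_combination x ^ 3 * (w ^ 3 + 1) * w3
  have d0 := ramTheta_one_dissection h0 hx
  have d1 := ramTheta_one_dissection h1 hx1
  have d2 := ramTheta_one_dissection h2 hx2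
  have p9 (y : 𝕜) : y ^ 9 = (y ^ 3) ^ 3 := by ring
  have p6 (y : 𝕜) : y ^ 6 = (y ^ 3) ^ 2 := by ring
  rw [p9, p6, c1, ← p9, ← p6] at d1
  rw [p9, p6, c2, ← p9, ← p6] at d2
  have m0 := ramTheta_one_mul h0 hx
  have m1 := ramTheta_one_mul h1 hx1
  have m2 := ramTheta_one_mul h2 hx2
  have m3 := ramTheta_one_mul (pow_ne_zero 3 h0) h3
  have m9 := ramTheta_one_mul (pow_ne_zero 9 h0) h9
  have k1 := eulerProd_cubic hw hx
  have k2 := eulerProd_sq_cubic hw hx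
  have prod : 8 * ramTheta (x ^ 3) (x ^ 6) ^ 3 + x ^ 3 * ramTheta 1 (x ^ 9) ^ 3 =
      ramTheta 1 x * ramTheta 1 (w * x) * ramTheta 1 (w ^ 2 * x) := by
    rw [d0, d1, d2]
    generalize ramTheta (x ^ 3) (x ^ 6) = A
    generalize ramTheta 1 (x ^ 9) = B
    linear_combination (-4 * A ^ 2 * x * B - 2 * A * x ^ 2 * B ^ 2 * w -
      x ^ 3 * B ^ 3 * (w - 1)) * hw
  rw [prod]
  rw [← eq_div_iff (eulerProd_ne_zero hx)] at m0
  rw [← eq_div_iff (eulerProd_ne_zero hx1)] at m1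
  rw [← eq_div_iff (eulerProd_ne_zero hx2)] at m2
  rw [← eq_div_iff (eulerProd_ne_zero h3)] at m3
  rw [← eq_div_iff (eulerProd_ne_zero h9)] at m9
  rw [m0, m1, m2, m3, m9, div_pow, ← k1, mul_pow 2 (eulerProd ((x ^ 3) ^ 2) ^ 2),
    pow_right_comm (eulerProd ((x ^ 3) ^ 2)) 2 4, ← k2]
  have := eulerProd_ne_zero hx; have := eulerProd_ne_zero hx1
  have := eulerProd_ne_zero hx2; have := eulerProd_ne_zero h9
  field_simp

end ThetaIdentities

/-! ### The well-poised series and its q-difference equation. -/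

section CubicSeries

/-- The finite `q`-Pochhammer symbol `(c; Q)_n`. -/
def shiftedPoch (c Q : ℝ) (n : ℕ) : ℝ := ∏ j ∈ Finset.range n, (1 - c * Q ^ j)

theorem shiftedPoch_succ (c Q : ℝ) (n : ℕ) :
    shiftedPoch c Q (n + 1) = shiftedPoch c Q n * (1 - c * Q ^ n) :=
  Finset.prod_range_succ _ _

theorem one_sub_mul_shiftedPoch (c Q : ℝ) (n : ℕ) :
    (1 - c) * shiftedPoch (c * Q) Q n = shiftedPoch c Q (n + 1) := by
  rw [shiftedPoch, shiftedPoch, Finset.prod_range_succ', mul_comm]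
  congr 1
  · exact Finset.prod_congr rfl fun n _ => by ring
  · simp

theorem abs_shiftedPoch_le_one {c Q : ℝ} (hc : 0 ≤ c) (hc1 : c ≤ 1) (hQ : 0 ≤ Q) (hQ1 : Q ≤ 1)
    (n : ℕ) : |shiftedPoch c Q n| ≤ 1 := by
  rw [shiftedPoch, Finset.abs_prod]
  refine Finset.prod_le_one (fun _ _ => abs_nonneg _) fun j _ => ?_
  have h1 : 0 ≤ c * Q ^ j := by positivity
  have h2 : c * Q ^ j ≤ 1 := mul_le_one₀ hc1 (by positivity) (pow_le_one₀ hQ hQ1)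
  rw [abs_le]; constructor <;> linarith

/-- The common factor of the terms of the well-poised series attached to the cubic continued
fraction. -/
noncomputable def poisedCoeff (q a : ℝ) (n : ℕ) : ℝ :=
  (-1) ^ (n + 1) * a ^ (2 * n + 2) * q ^ (3 * (n + 1) ^ 2) *
    shiftedPoch (a ^ 2 * q ^ 2) (q ^ 2) n / finPoch (q ^ 2) (n + 1)

/-- The `(n + 1)`-st term of the well-poised series attached to the cubic continued fraction. -/
noncomputable def poisedTerm (q a : ℝ) (n : ℕ) : ℝ :=
  poisedCoeff q a n * ((1 + a) * (1 - a * q ^ (2 * n + 2)))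

/-- The telescoping certificate for the `q`-difference equation of `poisedSum`. -/
noncomputable def poisedCert (q a : ℝ) (n : ℕ) : ℝ :=
  poisedCoeff q a n * ((1 - q ^ (2 * n + 2)) * (a ^ 2 * q ^ (2 * n + 2) - (1 + a)))

/-- The well-poised series attached to the cubic continued fraction. -/
noncomputable def poisedSum (q a : ℝ) : ℝ := 1 + ∑' n, poisedTerm q a n

theorem abs_sq_lt_one {q : ℝ} (hq : |q| < 1) : ‖q ^ 2‖ < 1 :=
  norm_pow_lt_one (by rwa [Real.norm_eq_abs]) two_ne_zero

/-- Rests on (1-a²q²)(a²q⁴;q²)_n = (a²q²;q²)_{n+1}; keeping the factor on the left avoids a division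
that fails at a²q² = 1. -/
theorem poisedCoeff_mul_q (q a : ℝ) (n : ℕ) :
    (1 - a ^ 2 * q ^ 2) * poisedCoeff q (a * q) n =
      poisedCoeff q a n * (q ^ (2 * n + 2) * (1 - a ^ 2 * q ^ (2 * n + 2))) := by
  have s1 := one_sub_mul_shiftedPoch (a ^ 2 * q ^ 2) (q ^ 2) n
  rw [shiftedPoch_succ, ← pow_mul, mul_assoc (a ^ 2) (q ^ 2) (q ^ (2 * n)), ← pow_add,
    add_comm 2] at s1
  rw [poisedCoeff, poisedCoeff, show (a * q) ^ 2 * q ^ 2 = a ^ 2 * q ^ 2 * q ^ 2 by ring, mul_pow]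
  linear_combination ((-1) ^ (n + 1) * (a ^ (2 * n + 2) * q ^ (2 * n + 2)) *
    q ^ (3 * (n + 1) ^ 2) / finPoch (q ^ 2) (n + 1)) * s1

theorem poisedCoeff_succ {q : ℝ} (hq : |q| < 1) (a : ℝ) (n : ℕ) :
    poisedCoeff q a (n + 1) * (1 - q ^ (2 * n + 2) * q ^ 2) =
      -poisedCoeff q a n * (a ^ 2 * q ^ 3 * (q ^ (2 * n + 2)) ^ 3 *
        (1 - a ^ 2 * q ^ (2 * n + 2))) := by
  have hp1 := finPoch_ne_zero (abs_sq_lt_one hq) (n + 1)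
  have hp2 := finPoch_ne_zero (abs_sq_lt_one hq) (n + 2)
  have e1 : a ^ 2 * q ^ (2 * n + 2) = a ^ 2 * q ^ 2 * (q ^ 2) ^ n := by
    rw [mul_assoc, ← pow_mul, ← pow_add, add_comm 2]
  have e2 : q ^ (2 * n + 2) * q ^ 2 = (q ^ 2) ^ (n + 2) := by
    rw [← pow_mul, ← pow_add]; congr 1
  have e3 : q ^ (3 * (n + 1 + 1) ^ 2) =
      q ^ (3 * (n + 1) ^ 2) * (q ^ 3 * (q ^ (2 * n + 2)) ^ 3) := by
    rw [← pow_mul, ← pow_add, ← pow_add]; congr 1; ring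
  have e4 : a ^ (2 * (n + 1) + 2) = a ^ (2 * n + 2) * a ^ 2 := by rw [← pow_add]; congr 1
  rw [show n + 2 = n + 1 + 1 from rfl, finPoch_succ] at hp2
  have hp3 := right_ne_zero_of_mul hp2
  rw [poisedCoeff, poisedCoeff, e1, e2, e3, e4, finPoch_succ (q ^ 2) (n + 1), shiftedPoch_succ,
    pow_succ (-1 : ℝ) (n + 1), div_mul_eq_mul_div, div_eq_iff hp2]
  field_simp

/-- Creative telescoping. The factor 1+a of the shifted terms combines with 1-aq and 1-aq² into
1-a²q² and 1-a²q⁴, exactly what `poisedCoeff_mul_q` needs; a polynomial identity in a, q and y =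
q^{2n+2} remains. -/
theorem poisedTerm_sub {q : ℝ} (hq : |q| < 1) (a : ℝ) (n : ℕ) :
    poisedTerm q a n - (1 - a * q) * poisedTerm q (a * q) n -
      a * q * (1 - a ^ 2 * q ^ 2) * (1 - a * q ^ 2) * poisedTerm q (a * q ^ 2) n =
    poisedCert q a (n + 1) - poisedCert q a n := by
  have c1 := poisedCoeff_mul_q q a n
  have c2 := poisedCoeff_mul_q q (a * q) n
  have c3 := poisedCoeff_succ hq a n
  rw [mul_assoc a q q, ← sq] at c2
  simp only [poisedTerm, poisedCert]
  rw [show 2 * (n + 1) + 2 = 2 * n + 2 + 2 by ring, pow_add q (2 * n + 2) 2]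
  generalize q ^ (2 * n + 2) = y at *
  generalize poisedCoeff q a n = K at *
  generalize poisedCoeff q (a * q) n = K1 at *
  generalize poisedCoeff q (a * q ^ 2) n = K2 at *
  generalize poisedCoeff q a (n + 1) = K3 at *
  linear_combination (-(1 - a * q * y) - a * q * (1 - a * q ^ 2 * y) * y *
    (1 - (a * q) ^ 2 * y)) * c1 - (a * q * (1 - a ^ 2 * q ^ 2) * (1 - a * q ^ 2 * y)) * c2 -
    (a ^ 2 * (y * q ^ 2) - (1 + a)) * c3

/-- D does not depend on a. The factor |q|^n gives summability; the factor |a| makes the series part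
of S(q^m) vanish as m → ∞. -/
theorem exists_bound_poisedCoeff {q : ℝ} (hq : |q| < 1) :
    ∃ D, 0 ≤ D ∧ ∀ a, |a| ≤ 1 → ∀ n, |poisedCoeff q a n| ≤ D * (|a| * |q| ^ n) := by
  obtain ⟨D, hD⟩ := ((tendsto_finPoch (abs_sq_lt_one hq)).inv₀
    (eulerProd_ne_zero (abs_sq_lt_one hq))).norm.bddAbove_range
  refine ⟨D, (norm_nonneg _).trans (hD ⟨0, rfl⟩), fun a ha n => ?_⟩
  have hq2 : q ^ 2 ≤ 1 := by rw [sq_le_one_iff_abs_le_one]; exact hq.le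
  have ha2 : a ^ 2 ≤ 1 := by rwa [sq_le_one_iff_abs_le_one]
  have h1 : |shiftedPoch (a ^ 2 * q ^ 2) (q ^ 2) n| ≤ 1 :=
    abs_shiftedPoch_le_one (by positivity) (mul_le_one₀ ha2 (sq_nonneg _) hq2) (sq_nonneg _) hq2 n
  have h2 : |(finPoch (q ^ 2) (n + 1))⁻¹| ≤ D := hD ⟨n + 1, rfl⟩
  have h3 : |a| ^ (2 * n + 2) ≤ |a| := pow_le_of_le_one (abs_nonneg _) ha (by omega)
  have h4 : |q| ^ (3 * (n + 1) ^ 2) ≤ |q| ^ n :=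
    pow_le_pow_of_le_one (abs_nonneg _) hq.le (by nlinarith)
  rw [poisedCoeff, div_eq_mul_inv, abs_mul, abs_mul, abs_mul, abs_mul, abs_pow, abs_pow, abs_pow,
    abs_neg, abs_one, one_pow, one_mul]
  calc _ ≤ |a| * |q| ^ n * 1 * D := by gcongr
    _ = _ := by ring

theorem abs_q_pow_le_one {q : ℝ} (hq : |q| < 1) (k : ℕ) : |q ^ k| ≤ 1 := by
  rw [abs_pow]; exact pow_le_one₀ (abs_nonneg _) hq.le

theorem exists_bound_poisedTerm {q : ℝ} (hq : |q| < 1) :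
    ∃ D, 0 ≤ D ∧ ∀ a, |a| ≤ 1 → ∀ n, |poisedTerm q a n| ≤ D * |a| * |q| ^ n := by
  obtain ⟨D, hD0, hD⟩ := exists_bound_poisedCoeff hq
  refine ⟨D * 4, by positivity, fun a ha n => ?_⟩
  have h1 : |1 + a| ≤ 2 := (abs_add_le _ _).trans (by rw [abs_one]; linarith)
  have h2 : |1 - a * q ^ (2 * n + 2)| ≤ 2 := by
    refine (abs_sub _ _).trans ?_
    rw [abs_one, abs_mul]
    linarith [mul_le_one₀ ha (abs_nonneg _) (abs_q_pow_le_one hq (2 * n + 2))]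
  rw [poisedTerm, abs_mul, abs_mul]
  calc _ ≤ D * (|a| * |q| ^ n) * (2 * 2) := by gcongr; exact hD a ha n
    _ = _ := by ring

theorem summable_poisedTerm {q : ℝ} (hq : |q| < 1) {a : ℝ} (ha : |a| ≤ 1) :
    Summable (poisedTerm q a) := by
  obtain ⟨D, -, hD⟩ := exists_bound_poisedTerm hq
  exact Summable.of_norm_bounded ((summable_geometric_of_lt_one (abs_nonneg q) hq).mul_left
    (D * |a|)) (hD a ha)

theorem tendsto_poisedCert {q : ℝ} (hq : |q| < 1) {a : ℝ} (ha : |a| ≤ 1) :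
    Tendsto (poisedCert q a) atTop (𝓝 0) := by
  obtain ⟨D, hD0, hD⟩ := exists_bound_poisedCoeff hq
  have lim : Tendsto (fun n => D * (1 * |q| ^ n) * (2 * 3)) atTop (𝓝 (D * (1 * 0) * (2 * 3))) :=
    (((tendsto_pow_atTop_nhds_zero_of_lt_one (abs_nonneg q) hq).const_mul 1).const_mul
      D).mul_const _
  rw [mul_zero, mul_zero, zero_mul] at lim
  refine squeeze_zero_norm (fun n => ?_) lim
  have hy := abs_q_pow_le_one hq (2 * n + 2)
  have ha2 : |a ^ 2| ≤ 1 := by rw [abs_pow]; exact pow_le_one₀ (abs_nonneg _) ha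
  have h1 : |1 - q ^ (2 * n + 2)| ≤ 2 := (abs_sub _ _).trans (by rw [abs_one]; linarith)
  have h2 : |a ^ 2 * q ^ (2 * n + 2) - (1 + a)| ≤ 3 := by
    refine (abs_sub _ _).trans ?_
    have := abs_add_le 1 a
    rw [abs_one] at this
    rw [abs_mul]
    linarith [mul_le_one₀ ha2 (abs_nonneg _) hy]
  rw [poisedCert, norm_mul, norm_mul, Real.norm_eq_abs, Real.norm_eq_abs, Real.norm_eq_abs]
  gcongr
  exact (hD a ha n).trans (by gcongr)

/-- The `q`-difference equation satisfied by the well-poised series. -/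
theorem poisedSum_recurrence {q : ℝ} (hq : |q| < 1) {a : ℝ} (ha : |a| ≤ 1) :
    poisedSum q a = (1 - a * q) * poisedSum q (a * q) +
      a * q * (1 - a ^ 2 * q ^ 2) * (1 - a * q ^ 2) * poisedSum q (a * q ^ 2) := by
  have ha1 : |a * q| ≤ 1 := by
    rw [abs_mul]; exact mul_le_one₀ ha (abs_nonneg _) hq.le
  have ha2 : |a * q ^ 2| ≤ 1 := by
    rw [abs_mul]; exact mul_le_one₀ ha (abs_nonneg _) (abs_q_pow_le_one hq 2)
  have s := ((summable_poisedTerm hq ha).hasSum.sub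
    ((summable_poisedTerm hq ha1).hasSum.mul_left (1 - a * q))).sub
    ((summable_poisedTerm hq ha2).hasSum.mul_left (a * q * (1 - a ^ 2 * q ^ 2) * (1 - a * q ^ 2)))
  simp only [poisedTerm_sub hq] at s
  have s1 := s.tendsto_sum_nat
  simp only [Finset.sum_range_sub] at s1
  have s2 := tendsto_nhds_unique s1 ((tendsto_poisedCert hq ha).sub_const _)
  -- The telescoped sum is minus this boundary value, which cancels the contribution of the constant
  -- terms 1 of the three series.
  have c0 : poisedCert q a 0 = a ^ 2 * q ^ 3 * (1 + a - a ^ 2 * q ^ 2) := by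
    have : 1 - q ^ 2 ≠ 0 := one_sub_ne_zero_of_norm_lt (abs_sq_lt_one hq)
    simp [poisedCert, poisedCoeff, shiftedPoch, finPoch]
    field_simp
    ring
  rw [c0] at s2
  simp only [poisedSum]
  linear_combination s2

theorem tendsto_poisedSum {q : ℝ} (hq : |q| < 1) :
    Tendsto (fun m : ℕ => poisedSum q (q ^ m)) atTop (𝓝 1) := by
  obtain ⟨D, hD0, hD⟩ := exists_bound_poisedTerm hq
  have lim : Tendsto (fun m : ℕ => D * |q| ^ m * (1 - |q|)⁻¹) atTop (𝓝 (D * 0 * (1 - |q|)⁻¹)) :=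
    ((tendsto_pow_atTop_nhds_zero_of_lt_one (abs_nonneg q) hq).const_mul D).mul_const _
  rw [mul_zero, zero_mul] at lim
  have h : Tendsto (fun m : ℕ => ∑' n, poisedTerm q (q ^ m) n) atTop (𝓝 0) := by
    refine squeeze_zero_norm (fun m => ?_) lim
    refine tsum_of_norm_bounded ((hasSum_geometric_of_lt_one (abs_nonneg q) hq).mul_left
      (D * |q| ^ m)) fun n => ?_
    rw [← abs_pow]
    exact (hD _ (abs_q_pow_le_one hq m) n).trans (by rw [abs_pow])
  simpa [poisedSum] using h.const_add 1

end CubicSeries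

/-! ### The series at a = 1 and a = q as theta functions. -/

section PoisedValues

theorem ramTheta_eq_tsum_nat {a b : ℝ} (ha : a ≠ 0) (hb : b ≠ 0) (hab : ‖a * b‖ < 1) :
    HasSum (fun n : ℕ => thetaTerm a b n + thetaTerm a b (-(n + 1))) (ramTheta a b) := by
  have s := summable_thetaTerm ha hb hab
  have s1 : Summable fun n : ℕ => thetaTerm a b n := s.comp_injective Nat.cast_injective
  have s2 : Summable fun n : ℕ => thetaTerm a b (-(n + 1)) :=
    s.comp_injective (i := fun n : ℕ => -((n : ℤ) + 1)) fun m n h => by simpa using h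
  rw [ramTheta, tsum_of_nat_of_neg_add_one s1 s2]
  exact s1.hasSum.add s2.hasSum

theorem thetaTerm_neg_self (y : ℝ) (n : ℤ) (m : ℕ) (h : n.natAbs = m) :
    thetaTerm (-y) (-y) n = (-1) ^ m * y ^ (m ^ 2) := by
  obtain ⟨T, hT⟩ := exists_half_mul_succ m
  have hm : thetaTerm (-y) (-y) n = thetaTerm (-y) (-y) m := by
    rcases Int.natAbs_eq n with hn | hn <;> rw [hn, h]
    rw [thetaTerm_neg]
  have hT0 : 0 ≤ T := by nlinarith [Int.natCast_nonneg m]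
  have hT1 : 0 ≤ T - m := by nlinarith [Int.natCast_nonneg m]
  lift T to ℕ using hT0
  obtain ⟨S, hS⟩ := Int.eq_ofNat_of_zero_le hT1
  rw [hm, thetaTerm_eq_zpow _ _ hT, hS, zpow_natCast, zpow_natCast, ← pow_add,
    show T + S = m ^ 2 by zify; linear_combination -hT - hS, neg_pow]
  congr 1
  rcases Nat.even_or_odd m with h | h
  · rw [h.neg_one_pow, (h.pow_of_ne_zero two_ne_zero).neg_one_pow]
  · rw [h.neg_one_pow, h.pow.neg_one_pow]

theorem thetaTerm_neg_five_nat {q : ℝ} (n : ℕ) :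
    thetaTerm (-q ^ 5) (-q) n = (-1) ^ n * q ^ (3 * n ^ 2 + 2 * n) := by
  obtain ⟨T, hT⟩ := exists_half_mul_succ n
  have hT0 : 0 ≤ T := by nlinarith [Int.natCast_nonneg n]
  have hT1 : 0 ≤ T - n := by nlinarith [Int.natCast_nonneg n]
  lift T to ℕ using hT0
  obtain ⟨S, hS⟩ := Int.eq_ofNat_of_zero_le hT1
  have hTS : T = S + n := by omega
  rw [thetaTerm_eq_zpow _ _ hT, hS, zpow_natCast, zpow_natCast, neg_pow (q ^ 5), neg_pow q,
    mul_mul_mul_comm, ← pow_add, ← pow_mul, ← pow_add,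
    show 5 * T + S = 3 * n ^ 2 + 2 * n by zify; linear_combination -3 * hT - hS, hTS,
    show S + n + S = 2 * S + n by ring, pow_add, pow_mul]
  norm_num

theorem thetaTerm_neg_five_negSucc {q : ℝ} (h0 : q ≠ 0) (n : ℕ) :
    thetaTerm (-q ^ 5) (-q) (-(n + 1)) =
      -((-1) ^ n * q ^ (3 * n ^ 2 + 2 * n) * q ^ (2 * n + 1)) := by
  have h := thetaTerm_succ (a := -q) (b := -q ^ 5) (neg_ne_zero.2 h0)
    (neg_ne_zero.2 (pow_ne_zero 5 h0)) n
  rw [thetaTerm_neg, h]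
  obtain ⟨T, hT⟩ := exists_half_mul_succ n
  have hT0 : 0 ≤ T := by nlinarith [Int.natCast_nonneg n]
  have hT1 : 0 ≤ T - n := by nlinarith [Int.natCast_nonneg n]
  lift T to ℕ using hT0
  obtain ⟨S, hS⟩ := Int.eq_ofNat_of_zero_le hT1
  have hTS : T = S + n := by omega
  rw [thetaTerm_eq_zpow _ _ hT, hS, zpow_natCast, zpow_natCast, zpow_natCast, neg_pow (q ^ 5),
    neg_pow q, show 3 * n ^ 2 + 2 * n = 5 * T + S by zify; linear_combination 3 * hT + hS,
    hTS, show -q * -q ^ 5 = q ^ 6 by ring]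
  have : ((-1 : ℝ) ^ S) * (-1) ^ S = 1 := by rw [← mul_pow]; norm_num
  have e : q ^ (5 * (S + n) + S) * q ^ (2 * n + 1) =
      q ^ (S + n) * (q ^ 5) ^ S * (q * (q ^ 6) ^ n) := by
    ring
  rw [mul_assoc _ (q ^ (5 * (S + n) + S)), e, pow_add (-1 : ℝ) S n]
  linear_combination (-(-1) ^ n * (q ^ (S + n) * (q ^ 5) ^ S * (q * (q ^ 6) ^ n))) * this

theorem tsum_int_eq_zero_add {f : ℤ → ℝ} (hf : Summable f) :
    ∑' n, f n = f 0 + ∑' n : ℕ, (f (n + 1) + f (-(n + 1))) := by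
  have s1 : Summable fun n : ℕ => f (n + 1) :=
    hf.comp_injective (i := fun n : ℕ => (n : ℤ) + 1) fun m n h => by simpa using h
  have s2 : Summable fun n : ℕ => f (-(n + 1)) :=
    hf.comp_injective (i := fun n : ℕ => -((n : ℤ) + 1)) fun m n h => by simpa using h
  rw [(HasSum.of_add_one_of_neg_add_one s1.hasSum s2.hasSum).tsum_eq, s1.tsum_add s2]
  ring

/-- At a = 1 the factor 1-q^{2n+2} completes the numerator to (q²;q²)_{n+1}, which cancels the
denominator, and 1+a = 2 counts the indices ±(n+1). -/
theorem poisedSum_one {q : ℝ} (hq : |q| < 1) (h0 : q ≠ 0) :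
    poisedSum q 1 = ramTheta (-q ^ 3) (-q ^ 3) := by
  have h3 : -q ^ 3 ≠ 0 := neg_ne_zero.2 (pow_ne_zero 3 h0)
  have n6 : ‖-q ^ 3 * -q ^ 3‖ < 1 := by
    rw [show -q ^ 3 * -q ^ 3 = q ^ 6 by ring]; exact norm_pow_lt_one hq (by norm_num)
  rw [ramTheta, tsum_int_eq_zero_add (summable_thetaTerm h3 h3 n6), poisedSum, thetaTerm_zero]
  congr 1
  refine tsum_congr fun n => ?_
  have hp := finPoch_ne_zero (abs_sq_lt_one hq) (n + 1)
  have e : shiftedPoch (1 ^ 2 * q ^ 2) (q ^ 2) n * (1 - q ^ (2 * n + 2)) =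
      finPoch (q ^ 2) (n + 1) := by
    rw [one_pow, one_mul, finPoch_succ, ← pow_mul, mul_add, mul_one, shiftedPoch, finPoch]
  have e1 : thetaTerm (-q ^ 3) (-q ^ 3) ((n : ℤ) + 1) =
      (-1) ^ (n + 1) * q ^ (3 * (n + 1) ^ 2) := by
    rw [thetaTerm_neg_self _ _ (n + 1) (by omega), ← pow_mul]
  have e2 : thetaTerm (-q ^ 3) (-q ^ 3) (-((n : ℤ) + 1)) =
      (-1) ^ (n + 1) * q ^ (3 * (n + 1) ^ 2) := by
    rw [thetaTerm_neg, ← e1]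
  rw [e1, e2, poisedTerm, poisedCoeff, one_pow (2 * n + 2), one_mul (q ^ (2 * n + 2)),
    div_mul_eq_mul_div, div_eq_iff hp, ← e]
  ring

/-- At a = q the prefactor 1-q and the factor 1+a complete the numerator to (q²;q²)_{n+1}; the
remaining 1-q^{2n+3} pairs the theta indices n+1 and -(n+2). -/
theorem one_sub_mul_poisedSum_self {q : ℝ} (hq : |q| < 1) (h0 : q ≠ 0) :
    (1 - q) * poisedSum q q = ramTheta (-q) (-q ^ 5) := by
  have h5 : -q ^ 5 ≠ 0 := neg_ne_zero.2 (pow_ne_zero 5 h0)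
  have n6 : ‖-q ^ 5 * -q‖ < 1 := by
    rw [show -q ^ 5 * -q = q ^ 6 by ring]; exact norm_pow_lt_one hq (by norm_num)
  have s := ramTheta_eq_tsum_nat h5 (neg_ne_zero.2 h0) n6
  rw [ramTheta_comm, ← s.tsum_eq, s.summable.tsum_eq_zero_add, poisedSum, mul_add, ← tsum_mul_left]
  congr 1
  · rw [thetaTerm_neg_five_negSucc h0, thetaTerm_neg_five_nat]; simp; ring
  · refine tsum_congr fun n => ?_
    rw [thetaTerm_neg_five_negSucc h0, thetaTerm_neg_five_nat, poisedTerm, poisedCoeff]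
    have hp := finPoch_ne_zero (abs_sq_lt_one hq) (n + 1)
    have e := one_sub_mul_shiftedPoch (q ^ 2) (q ^ 2) n
    have hfin : shiftedPoch (q ^ 2) (q ^ 2) (n + 1) = finPoch (q ^ 2) (n + 1) := rfl
    rw [hfin] at e
    rw [div_mul_eq_mul_div, mul_div_assoc', div_eq_iff hp, ← e]
    ring

end PoisedValues

/-! ### Convergence of the continued fraction and its product formula. -/

section ContinuedFraction

/-- A solution of the three-term recurrence of the continuants is bounded when the partial
numerators are absolutely summable. -/
theorem exists_bound_of_recurrence {c X : ℕ → ℝ} (hc : Summable fun n => |c (n + 1)|)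
    (hX : ∀ n, X (n + 2) = X (n + 1) + c (n + 1) * X n) : ∃ M, ∀ n, |X n| ≤ M := by
  have hm : Multipliable fun n => 1 + |c (n + 1)| :=
    multipliable_one_add_of_summable (by simpa using hc)
  obtain ⟨P, hP⟩ := hm.hasProd.tendsto_prod_nat.bddAbove_range
  -- Two consecutive terms are bounded together, each step costing a factor 1+|c|.
  have key (n : ℕ) :
      |X n| ≤ (∏ j ∈ Finset.range n, (1 + |c (j + 1)|)) * (|X 0| + |X 1|) ∧
      |X (n + 1)| ≤ (∏ j ∈ Finset.range n, (1 + |c (j + 1)|)) * (|X 0| + |X 1|) := by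
    induction n with
    | zero => simp
    | succ n ih =>
      rw [Finset.prod_range_succ]
      set M := ∏ j ∈ Finset.range n, (1 + |c (j + 1)|)
      have h1 := mul_le_mul_of_nonneg_left ih.1 (abs_nonneg (c (n + 1)))
      have h2 := (abs_nonneg _).trans ih.1
      have h3 := mul_nonneg (abs_nonneg (c (n + 1))) h2
      have h4 : |X (n + 2)| ≤ |X (n + 1)| + |c (n + 1)| * |X n| := by
        rw [hX, ← abs_mul]; exact abs_add_le _ _
      constructor
      · linarith [ih.2]
      · linarith [ih.2]
  refine ⟨P * (|X 0| + |X 1|), fun n => (key n).1.trans ?_⟩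
  gcongr
  exact hP ⟨n, rfl⟩

/-- The limit of a solution of the continuant recurrence in terms of a convergent solution of the
adjoint recurrence. -/
theorem tendsto_of_recurrence {c X F : ℕ → ℝ} {L : ℝ} (hc : Summable fun n => |c (n + 1)|)
    (hX : ∀ n, X (n + 2) = X (n + 1) + c (n + 1) * X n)
    (hF : ∀ n, F n = F (n + 1) + c (n + 1) * F (n + 2)) (hL : L ≠ 0)
    (hFL : Tendsto F atTop (𝓝 L)) :
    Tendsto X atTop (𝓝 ((X 1 * F 1 + c 1 * X 0 * F 2) / L)) := by
  -- Conserved pairing of the two adjoint recurrences. Its second summand tends to 0, since c → 0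
  -- and X is bounded, so X·F converges.
  have inv (n : ℕ) : X (n + 1) * F (n + 1) + c (n + 1) * X n * F (n + 2) =
      X 1 * F 1 + c 1 * X 0 * F 2 := by
    induction n with
    | zero => rfl
    | succ n ih => rw [← ih, hX n, hF (n + 1)]; ring
  obtain ⟨M, hM⟩ := exists_bound_of_recurrence hc hX
  have hc0 : Tendsto (fun n => c (n + 1)) atTop (𝓝 0) :=
    (tendsto_zero_iff_abs_tendsto_zero _).2 hc.tendsto_atTop_zero
  have h1 : Tendsto (fun n => c (n + 1) * X n) atTop (𝓝 0) :=
    hc0.zero_mul_isBoundedUnder_le (isBoundedUnder_of ⟨M, hM⟩)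
  have hF1 := (tendsto_add_atTop_iff_nat 1).2 hFL
  have hF2 := (tendsto_add_atTop_iff_nat 2).2 hFL
  have h2 := (((h1.mul hF2).const_sub (X 1 * F 1 + c 1 * X 0 * F 2)).div hF1 hL)
  rw [zero_mul, sub_zero] at h2
  refine (tendsto_add_atTop_iff_nat 1).1 (h2.congr' ?_)
  filter_upwards [hF1.eventually_ne hL] with n hn
  rw [Pi.div_apply, ← inv n, add_sub_cancel_right, mul_div_cancel_right₀ _ hn]

theorem cubicContFract_get (q : ℝ) (n : ℕ) :
    (cubicContFract q).s.get? (n + 1) = some ⟨q ^ (n + 1) + q ^ (2 * (n + 1)), 1⟩ := rfl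

theorem cubicContFract_get_zero (q : ℝ) :
    (cubicContFract q).s.get? 0 = some ⟨cubeRoot q, 1⟩ := rfl

theorem poisedSum_one_ne_zero {q : ℝ} (hq : |q| < 1) : poisedSum q 1 ≠ 0 := by
  rcases eq_or_ne q 0 with rfl | h0
  · simp [poisedSum, poisedTerm, poisedCoeff]
  · rw [poisedSum_one hq h0]
    exact ramTheta_neg_self_ne_zero (pow_ne_zero 3 h0) (norm_pow_lt_one hq three_ne_zero)

theorem tendsto_cubicContFract {q : ℝ} (hq : |q| < 1) :
    Tendsto (fun n : ℕ => (cubicContFract q).convs n) atTop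
      (𝓝 (cubeRoot q * ((1 - q) * poisedSum q q / poisedSum q 1))) := by
  set c : ℕ → ℝ := fun n => q ^ n + q ^ (2 * n) with hcdef
  -- The factor (q;q)_m absorbs 1-q^{m+1} and 1-q^{m+2} from the q-difference equation, leaving
  -- q^{m+1}(1+q^{m+1}) = c (m+1). The value c 0 never enters: the first partial numerator q^{1/3}
  -- comes in through the initial values.
  set F : ℕ → ℝ := fun m => poisedSum q (q ^ m) * finPoch q m with hFdef
  have hE : eulerProd q ≠ 0 := eulerProd_ne_zero hq
  have hc : Summable fun n => |c (n + 1)| := by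
    have g := (summable_geometric_of_lt_one (abs_nonneg q) hq)
    refine Summable.of_nonneg_of_le (fun _ => abs_nonneg _) (fun n => ?_) (g.mul_left 2)
    have h1 : |q| ^ (n + 1) ≤ |q| ^ n := pow_le_pow_of_le_one (abs_nonneg _) hq.le (by omega)
    have h2 : |q| ^ (2 * (n + 1)) ≤ |q| ^ n :=
      pow_le_pow_of_le_one (abs_nonneg _) hq.le (by omega)
    refine (abs_add_le _ _).trans ?_
    rw [abs_pow, abs_pow]; linarith
  have hF (m : ℕ) : F m = F (m + 1) + c (m + 1) * F (m + 2) := by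
    have h := poisedSum_recurrence hq (abs_q_pow_le_one hq m)
    simp only [hFdef, hcdef]
    rw [show m + 2 = m + 1 + 1 from rfl, finPoch_succ q (m + 1), finPoch_succ q m, pow_mul']
    rw [← pow_succ, ← pow_add, show m + 2 = m + 1 + 1 from rfl, ← mul_pow, ← pow_succ] at h
    rw [h]; ring
  have hFL : Tendsto F atTop (𝓝 (eulerProd q)) := by
    simpa using (tendsto_poisedSum hq).mul (tendsto_finPoch (Q := q) hq)
  have hA := tendsto_of_recurrence (X := (cubicContFract q).nums) hc
    (fun n => by rw [GenContFract.nums_recurrence (cubicContFract_get q n) rfl rfl, one_mul])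
    hF hE hFL
  have hB := tendsto_of_recurrence (X := (cubicContFract q).dens) hc
    (fun n => by rw [GenContFract.dens_recurrence (cubicContFract_get q n) rfl rfl, one_mul])
    hF hE hFL
  rw [GenContFract.first_num_eq (cubicContFract_get_zero q), GenContFract.zeroth_num_eq_h,
    show (cubicContFract q).h = 0 from rfl] at hA
  rw [GenContFract.first_den_eq (cubicContFract_get_zero q), GenContFract.zeroth_den_eq_one,
    one_mul, mul_one, ← hF 0] at hB
  have hF0 : F 0 = poisedSum q 1 := by simp [hFdef, finPoch]
  have hF1 : F 1 = (1 - q) * poisedSum q q := by simp [hFdef, finPoch, mul_comm]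
  have hT := poisedSum_one_ne_zero hq
  rw [hF0] at hB
  rw [hF1] at hA
  have := hA.div hB (div_ne_zero hT hE)
  convert! this using 2
  field_simp
  ring

theorem tendsto_cubicG {q : ℝ} (hq : |q| < 1) :
    Tendsto (fun n : ℕ => (cubicContFract q).convs n) atTop (𝓝 (cubicG q)) :=
  tendsto_nhds_limUnder ⟨_, tendsto_cubicContFract hq⟩

/-- The cubic continued fraction as a quotient of theta functions. -/
theorem cubicG_eq_theta {q : ℝ} (hq : |q| < 1) (h0 : q ≠ 0) :
    cubicG q = cubeRoot q * (ramTheta (-q) (-q ^ 5) / ramTheta (-q ^ 3) (-q ^ 3)) := by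
  rw [tendsto_nhds_unique (tendsto_cubicG hq) (tendsto_cubicContFract hq),
    one_sub_mul_poisedSum_self hq h0, poisedSum_one hq h0]

theorem hasProd_cubicFactor {q : ℝ} (hq : |q| < 1) :
    HasProd (cubicFactor q)
      (qPoch q (q ^ 6) * qPoch (q ^ 5) (q ^ 6) /
        (qPoch (q ^ 3) (q ^ 6) * qPoch (q ^ 3) (q ^ 6))) := by
  have h6 : ‖q ^ 6‖ < 1 := norm_pow_lt_one hq (by norm_num)
  have h3 := qPoch_ne_zero (norm_pow_lt_one hq three_ne_zero) h6
  have m (a : ℝ) := (multipliable_qPoch a h6).hasProd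
  convert! ((m q).mul (m (q ^ 5))).div₀ ((m (q ^ 3)).mul (m (q ^ 3))) (mul_ne_zero h3 h3) using 1
  ext j
  rw [cubicFactor]
  congr 1 <;> ring

theorem cubicG_eq_tprod {q : ℝ} (hq : |q| < 1) :
    cubicG q = cubeRoot q * ∏' j : ℕ, cubicFactor q j := by
  rcases eq_or_ne q 0 with rfl | h0
  · rw [tendsto_nhds_unique (tendsto_cubicG hq) (tendsto_cubicContFract hq)]
    simp [cubeRoot]
  · have h6 : ‖q ^ 6‖ < 1 := norm_pow_lt_one hq (by norm_num)
    have e1 : -q * -q ^ 5 = q ^ 6 := by ring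
    have e2 : -q ^ 3 * -q ^ 3 = q ^ 6 := by ring
    have h3 : -q ^ 3 ≠ 0 := neg_ne_zero.2 (pow_ne_zero 3 h0)
    rw [(hasProd_cubicFactor hq).tprod_eq, cubicG_eq_theta hq h0,
      ramTheta_eq_prod (neg_ne_zero.2 h0) (neg_ne_zero.2 (pow_ne_zero 5 h0)) (by rwa [e1]),
      ramTheta_eq_prod h3 h3 (by rwa [e2]), e1, e2, neg_neg, neg_neg, neg_neg,
      mul_div_mul_right _ _ (eulerProd_ne_zero h6)]

end ContinuedFraction

/-! ### The continued fraction at q = x³ in terms of φ and ψ. -/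

section CubicTheta

theorem ofReal_ramTheta (a b : ℝ) : ((ramTheta a b : ℝ) : ℂ) = ramTheta (a : ℂ) (b : ℂ) := by
  simp only [ramTheta, thetaTerm, Complex.ofReal_tsum, Complex.ofReal_mul, Complex.ofReal_zpow]

theorem exists_cubic_root_of_unity : ∃ w : ℂ, 1 + w + w ^ 2 = 0 := by
  obtain ⟨s, hs⟩ := IsAlgClosed.exists_pow_nat_eq (-3 : ℂ) two_pos
  exact ⟨(-1 + s) / 2, by linear_combination hs / 4⟩

/-- Proved over ℂ and descended, since ℝ has no primitive cube root of unity. -/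
theorem real_ramTheta_neg_self_quartic {x : ℝ} (h0 : x ≠ 0) (hx : |x| < 1) :
    (ramTheta (-x ^ 9) (-x ^ 9) ^ 3 - 8 * x ^ 3 * ramTheta (-x ^ 3) (-x ^ 15) ^ 3) *
      ramTheta (-x ^ 9) (-x ^ 9) = ramTheta (-x ^ 3) (-x ^ 3) ^ 4 := by
  obtain ⟨w, hw⟩ := exists_cubic_root_of_unity
  have h := ramTheta_neg_self_quartic hw (x := (x : ℂ)) (by exact_mod_cast h0) (by simpa using hx)
  rw [← Complex.ofReal_inj]
  push_cast [ofReal_ramTheta]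
  exact h

theorem real_ramTheta_one_quartic {x : ℝ} (h0 : x ≠ 0) (hx : |x| < 1) :
    (8 * ramTheta (x ^ 3) (x ^ 6) ^ 3 + x ^ 3 * ramTheta 1 (x ^ 9) ^ 3) * ramTheta 1 (x ^ 9) =
      ramTheta 1 (x ^ 3) ^ 4 := by
  obtain ⟨w, hw⟩ := exists_cubic_root_of_unity
  have h := ramTheta_one_quartic hw (x := (x : ℂ)) (by exact_mod_cast h0) (by simpa using hx)
  rw [← Complex.ofReal_inj]
  push_cast [ofReal_ramTheta]
  exact h

theorem cubeRoot_pow_three (x : ℝ) : cubeRoot (x ^ 3) = x := by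
  have h : |x ^ 3| ^ (1 / 3 : ℝ) = |x| := by
    rw [abs_pow, ← Real.rpow_natCast, ← Real.rpow_mul (abs_nonneg x)]
    norm_num
  rw [cubeRoot, h]
  rcases lt_trichotomy x 0 with hx | rfl | hx
  · rw [Real.sign_of_neg (Odd.pow_neg (by decide) hx), abs_of_neg hx]; ring
  · simp
  · rw [Real.sign_of_pos (by positivity), abs_of_pos hx, one_mul]

/-- Taking q = x³ removes the cube root, for either sign of x because the real cube root is odd. -/
theorem cubicG_pow_three {x : ℝ} (h0 : x ≠ 0) (hx : |x| < 1) :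
    cubicG (x ^ 3) * ramTheta (-x ^ 9) (-x ^ 9) = x * ramTheta (-x ^ 3) (-x ^ 15) := by
  have h9 := ramTheta_neg_self_ne_zero (pow_ne_zero 9 h0) (norm_pow_lt_one hx (by norm_num))
  rw [cubicG_eq_theta (norm_pow_lt_one (q := x) hx three_ne_zero) (pow_ne_zero 3 h0),
    cubeRoot_pow_three,
    ← pow_mul, ← pow_mul]
  field_simp

theorem cubicG_pow_three_ne_zero {x : ℝ} (h0 : x ≠ 0) (hx : |x| < 1) : cubicG (x ^ 3) ≠ 0 := by
  intro h
  have h1 := cubicG_pow_three h0 hx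
  have h2 := ramTheta_neg_five_ne_zero (pow_ne_zero 3 h0)
    (norm_pow_lt_one (q := x) hx three_ne_zero)
  rw [← pow_mul] at h2
  rw [h, zero_mul] at h1
  exact mul_ne_zero h0 h2 h1.symm

theorem one_sub_two_mul_cubicG {x : ℝ} (h0 : x ≠ 0) (hx : |x| < 1) :
    (1 - 2 * cubicG (x ^ 3)) * ramTheta (-x ^ 9) (-x ^ 9) = ramTheta (-x) (-x) := by
  rw [ramTheta_neg_self_dissection h0 hx]
  linear_combination -2 * cubicG_pow_three h0 hx

theorem one_sub_eight_mul_cubicG {x : ℝ} (h0 : x ≠ 0) (hx : |x| < 1) :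
    (1 - 8 * cubicG (x ^ 3) ^ 3) * ramTheta (-x ^ 9) (-x ^ 9) ^ 4 =
      ramTheta (-x ^ 3) (-x ^ 3) ^ 4 := by
  have h := congrArg (· ^ 3) (cubicG_pow_three h0 hx)
  simp only [mul_pow] at h
  rw [← real_ramTheta_neg_self_quartic h0 hx]
  linear_combination (-8 * ramTheta (-x ^ 9) (-x ^ 9)) * h

/-- Trades φ for ψ through `ramTheta_mul_relation`, so that the dissection of ψ applies to G. -/
theorem cubicG_mul_ramTheta {x : ℝ} (h0 : x ≠ 0) (hx : |x| < 1) :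
    cubicG (x ^ 3) * (2 * ramTheta (x ^ 3) (x ^ 6)) = x * ramTheta 1 (x ^ 9) := by
  have h9 := ramTheta_neg_self_ne_zero (pow_ne_zero 9 h0) (norm_pow_lt_one hx (by norm_num))
  have h1 := cubicG_pow_three h0 hx
  have h2 := ramTheta_mul_relation (pow_ne_zero 3 h0) (norm_pow_lt_one (q := x) hx three_ne_zero)
  rw [← pow_mul, ← pow_mul, ← pow_mul] at h2
  apply mul_right_cancel₀ h9
  linear_combination 2 * ramTheta (x ^ 3) (x ^ 6) * h1 + x * h2

theorem one_add_cubicG {x : ℝ} (h0 : x ≠ 0) (hx : |x| < 1) :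
    (1 + cubicG (x ^ 3)) * (x * ramTheta 1 (x ^ 9)) = cubicG (x ^ 3) * ramTheta 1 x := by
  rw [ramTheta_one_dissection h0 hx]
  linear_combination -cubicG_mul_ramTheta h0 hx

theorem one_add_cubicG_cube {x : ℝ} (h0 : x ≠ 0) (hx : |x| < 1) :
    (1 + cubicG (x ^ 3) ^ 3) * (x ^ 3 * ramTheta 1 (x ^ 9) ^ 4) =
      cubicG (x ^ 3) ^ 3 * ramTheta 1 (x ^ 3) ^ 4 := by
  have h := congrArg (· ^ 3) (cubicG_mul_ramTheta h0 hx)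
  simp only [mul_pow] at h
  rw [← real_ramTheta_one_quartic h0 hx]
  linear_combination (-ramTheta 1 (x ^ 9)) * h

end CubicTheta

/-! ### Modular transformations of φ and ψ. -/

section Transformation

open Real

theorem thetaTerm_self (y : ℝ) (n : ℤ) (h0 : y ≠ 0) : thetaTerm y y n = y ^ (n ^ 2) := by
  obtain ⟨T, hT⟩ := exists_half_mul_succ n
  rw [thetaTerm_eq_zpow _ _ hT, ← zpow_add₀ h0]
  congr 1
  linear_combination -hT

theorem ramTheta_exp_self (t : ℝ) :
    ramTheta (exp (-t)) (exp (-t)) = ∑' n : ℤ, exp (-t * (n : ℝ) ^ 2) := by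
  refine tsum_congr fun n => ?_
  rw [thetaTerm_self _ _ (exp_ne_zero _), ← rpow_intCast, ← exp_mul]
  push_cast
  rfl

/-- The transformation formula of `φ`. -/
theorem ramTheta_exp_transform {t : ℝ} (ht : 0 < t) :
    ramTheta (exp (-t)) (exp (-t)) =
      √(π / t) * ramTheta (exp (-(π ^ 2 / t))) (exp (-(π ^ 2 / t))) := by
  have h := Real.tsum_exp_neg_mul_int_sq (a := t / π) (by positivity)
  rw [ramTheta_exp_self, ramTheta_exp_self]
  rw [← Real.sqrt_eq_rpow, one_div, ← Real.sqrt_inv, inv_div] at h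
  convert h using 4
  · field_simp
  · congr 1
    field_simp

theorem ramTheta_even_odd {y : ℝ} (h0 : y ≠ 0) (hy : |y| < 1) :
    ramTheta y y = ramTheta (y ^ 4) (y ^ 4) + y * ramTheta 1 (y ^ 8) := by
  have h2 : ‖y * y‖ < 1 := by rw [← sq]; exact norm_pow_lt_one hy two_ne_zero
  rw [ramTheta, tsum_int_eq_sum_residues (summable_thetaTerm h0 h0 h2) 2, Fin.sum_univ_two,
    ramTheta, ramTheta_comm 1, ramTheta, ← tsum_mul_left]
  congr 1 <;> refine tsum_congr fun m => ?_
  · rw [thetaTerm_self _ _ h0, thetaTerm_self _ _ (pow_ne_zero 4 h0), ← zpow_natCast y 4,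
      ← zpow_mul]
    congr 1
    push_cast [Fin.val_zero]
    ring
  · obtain ⟨T, hT⟩ := exists_half_mul_succ m
    rw [thetaTerm_self _ _ h0, thetaTerm_eq_zpow _ _ hT, one_zpow, mul_one, ← zpow_natCast y 8,
      ← zpow_mul, ← zpow_one_add₀ h0]
    congr 1
    push_cast [Fin.val_one]
    linear_combination 4 * hT

theorem exp_neg_lt_one {t : ℝ} (ht : 0 < t) : |exp (-t)| < 1 := by
  rw [abs_of_pos (exp_pos _)]; rw [exp_lt_one_iff]; linarith

/-- The transformation formula between `φ(-q)` and `ψ(q)`. -/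
theorem ramTheta_neg_exp_transform {t : ℝ} (ht : 0 < t) :
    ramTheta (-exp (-t)) (-exp (-t)) =
      √(π / t) * (exp (-(π ^ 2 / (4 * t))) * ramTheta 1 (exp (-(2 * π ^ 2 / t)))) := by
  have h1 := ramTheta_even_odd (exp_ne_zero (-t)) (exp_neg_lt_one ht)
  have h2 := ramTheta_even_odd (neg_ne_zero.2 (exp_ne_zero (-t)))
    (by rw [abs_neg]; exact exp_neg_lt_one ht)
  rw [show (-exp (-t)) ^ 4 = exp (-t) ^ 4 by ring, show (-exp (-t)) ^ 8 = exp (-t) ^ 8 by ring]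
    at h2
  have h3 : 0 < π ^ 2 / (4 * t) := by positivity
  have h4 := ramTheta_even_odd (exp_ne_zero (-(π ^ 2 / (4 * t)))) (exp_neg_lt_one h3)
  have e1 : exp (-(π ^ 2 / (4 * t))) ^ 4 = exp (-(π ^ 2 / t)) := by
    rw [← exp_nat_mul]; congr 1; push_cast; field_simp
  have e2 : exp (-(π ^ 2 / (4 * t))) ^ 8 = exp (-(2 * π ^ 2 / t)) := by
    rw [← exp_nat_mul]; congr 1; push_cast; field_simp; norm_num
  have e3 : exp (-t) ^ 4 = exp (-(4 * t)) := by
    rw [← exp_nat_mul]; congr 1; push_cast; ring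
  rw [e1, e2] at h4
  -- Adding the dissections at ±e^{-t} gives φ(-e^{-t}) = 2φ(e^{-4t}) - φ(e^{-t}). With Q =
  -- e^{-π²/(4t)}, transforming both terms yields √(π/t)(φ(Q) - φ(Q⁴)) = √(π/t)·2Qψ(Q⁸).
  have t1 := ramTheta_exp_transform ht
  have t2 := ramTheta_exp_transform (t := 4 * t) (by positivity)
  have e4 : √(π / t) = 2 * √(π / (4 * t)) := by
    rw [show π / t = 2 ^ 2 * (π / (4 * t)) by field_simp; norm_num,
      Real.sqrt_mul (by positivity), Real.sqrt_sq (by norm_num)]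
  rw [e3] at h1 h2
  linear_combination h2 + h1 - t1 + 2 * t2 + √(π / t) * h4 -
    ramTheta (exp (-(π ^ 2 / (4 * t)))) (exp (-(π ^ 2 / (4 * t)))) * e4

theorem sqrt_pi_div {t c : ℝ} (ht : 0 < t) (hc : 0 < c) : √(π / t) = √c * √(π / (c * t)) := by
  rw [← Real.sqrt_mul hc.le]; congr 1; field_simp

/-- Comparing the transformation at t and at ct eliminates π/t and leaves only √c. -/
theorem ramTheta_exp_reciprocity {t c : ℝ} (ht : 0 < t) (hc : 0 < c) :
    ramTheta (exp (-t)) (exp (-t)) *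
        ramTheta (exp (-(π ^ 2 / (c * t)))) (exp (-(π ^ 2 / (c * t)))) =
      √c * (ramTheta (exp (-(c * t))) (exp (-(c * t))) *
        ramTheta (exp (-(π ^ 2 / t))) (exp (-(π ^ 2 / t)))) := by
  rw [ramTheta_exp_transform ht, ramTheta_exp_transform (mul_pos hc ht), sqrt_pi_div ht hc]
  ring

theorem ramTheta_neg_exp_reciprocity {t c : ℝ} (ht : 0 < t) (hc : 0 < c) :
    ramTheta (-exp (-t)) (-exp (-t)) *
        (exp (-(π ^ 2 / (4 * (c * t)))) * ramTheta 1 (exp (-(2 * π ^ 2 / (c * t))))) =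
      √c * (ramTheta (-exp (-(c * t))) (-exp (-(c * t))) *
        (exp (-(π ^ 2 / (4 * t))) * ramTheta 1 (exp (-(2 * π ^ 2 / t))))) := by
  rw [ramTheta_neg_exp_transform ht, ramTheta_neg_exp_transform (mul_pos hc ht), sqrt_pi_div ht hc]
  ring

theorem ramTheta_exp_ne_zero {t : ℝ} (ht : 0 < t) : ramTheta (exp (-t)) (exp (-t)) ≠ 0 := by
  have := ramTheta_neg_self_ne_zero (neg_ne_zero.2 (exp_ne_zero (-t)))
    (by rw [norm_neg]; exact exp_neg_lt_one ht)
  rwa [neg_neg] at this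

theorem ramTheta_neg_exp_ne_zero {t : ℝ} (ht : 0 < t) :
    ramTheta (-exp (-t)) (-exp (-t)) ≠ 0 :=
  ramTheta_neg_self_ne_zero (exp_ne_zero (-t)) (exp_neg_lt_one ht)

theorem ramTheta_one_exp_ne_zero {t : ℝ} (ht : 0 < t) : ramTheta 1 (exp (-t)) ≠ 0 := by
  intro h
  have h1 := ramTheta_one_mul (exp_ne_zero (-t)) (exp_neg_lt_one ht)
  rw [h, zero_mul] at h1
  exact mul_ne_zero two_ne_zero (pow_ne_zero 2 (eulerProd_ne_zero
    (norm_pow_lt_one (exp_neg_lt_one ht) two_ne_zero))) h1.symm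

end Transformation

/-! ### The four reciprocity formulas. -/

section Reciprocity

open Real

theorem reciprocity_iff (k : ℤ) {x₁ x₂ : ℝ} (h : x₁ + x₂ ≠ 0) :
    ((2 : ℝ) ^ k - x₁ * x₂) / (x₁ + x₂) = 1 ↔ (1 + x₁) * (1 + x₂) = 1 + (2 : ℝ) ^ k := by
  rw [div_eq_one_iff_eq h]
  constructor <;> intro h <;> linear_combination -h

/-- The sum cannot vanish: x₂ = -x₁ would give 1-x₁² = 1+2^k > 1. -/
theorem cubicReciprocity_of_mul {k : ℤ} {x₁ x₂ : ℝ} (h : (1 + x₁) * (1 + x₂) = 1 + (2 : ℝ) ^ k) :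
    CubicReciprocity k x₁ x₂ := by
  have hs : x₁ + x₂ ≠ 0 := by
    intro h0
    obtain rfl : x₂ = -x₁ := by linarith
    have := zpow_pos (two_pos : (0 : ℝ) < 2) k
    nlinarith [sq_nonneg x₁]
  exact ⟨h, hs, (reciprocity_iff k hs).2 h⟩

theorem exp_third_pow (α : ℝ) (k : ℕ) : exp (-(α / 3)) ^ k = exp (-(k * α / 3)) := by
  rw [← exp_nat_mul]; congr 1; ring

theorem cubicG_exp {α : ℝ} (hα : 0 < α) :
    (1 - 2 * cubicG (exp (-α))) * ramTheta (-exp (-(3 * α))) (-exp (-(3 * α))) =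
        ramTheta (-exp (-(α / 3))) (-exp (-(α / 3))) ∧
      (1 - 8 * cubicG (exp (-α)) ^ 3) * ramTheta (-exp (-(3 * α))) (-exp (-(3 * α))) ^ 4 =
        ramTheta (-exp (-α)) (-exp (-α)) ^ 4 ∧
      (1 + cubicG (exp (-α))) * (exp (-(α / 3)) * ramTheta 1 (exp (-(3 * α)))) =
        cubicG (exp (-α)) * ramTheta 1 (exp (-(α / 3))) ∧
      (1 + cubicG (exp (-α)) ^ 3) * (exp (-α) * ramTheta 1 (exp (-(3 * α))) ^ 4) =
        cubicG (exp (-α)) ^ 3 * ramTheta 1 (exp (-α)) ^ 4 := by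
  have h0 := exp_ne_zero (-(α / 3))
  have hx : |exp (-(α / 3))| < 1 := exp_neg_lt_one (by positivity)
  have e3 : exp (-(α / 3)) ^ 3 = exp (-α) := by
    rw [exp_third_pow]; congr 1; push_cast; ring
  have e9 : exp (-(α / 3)) ^ 9 = exp (-(3 * α)) := by
    rw [exp_third_pow]; congr 1; push_cast; ring
  have a := one_sub_two_mul_cubicG h0 hx
  have b := one_sub_eight_mul_cubicG h0 hx
  have c := one_add_cubicG h0 hx
  have d := one_add_cubicG_cube h0 hx
  rw [e3, e9] at a b c d
  exact ⟨a, b, c, d⟩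

theorem cubicG_neg_exp {α : ℝ} (hα : 0 < α) :
    cubicG (-exp (-α)) ≠ 0 ∧
      (1 - 2 * cubicG (-exp (-α))) * ramTheta (exp (-(3 * α))) (exp (-(3 * α))) =
        ramTheta (exp (-(α / 3))) (exp (-(α / 3))) ∧
      (1 - 8 * cubicG (-exp (-α)) ^ 3) * ramTheta (exp (-(3 * α))) (exp (-(3 * α))) ^ 4 =
        ramTheta (exp (-α)) (exp (-α)) ^ 4 := by
  have h0 : -exp (-(α / 3)) ≠ 0 := neg_ne_zero.2 (exp_ne_zero _)
  have hx : |-exp (-(α / 3))| < 1 := by rw [abs_neg]; exact exp_neg_lt_one (by positivity)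
  have e3 : (-exp (-(α / 3))) ^ 3 = -exp (-α) := by
    rw [Odd.neg_pow (by decide), exp_third_pow]; congr 2; push_cast; ring
  have e9 : (-exp (-(α / 3))) ^ 9 = -exp (-(3 * α)) := by
    rw [Odd.neg_pow (by decide), exp_third_pow]; congr 2; push_cast; ring
  have n := cubicG_pow_three_ne_zero h0 hx
  have a := one_sub_two_mul_cubicG h0 hx
  have b := one_sub_eight_mul_cubicG h0 hx
  rw [e3] at n
  rw [e3, e9, neg_neg] at a b
  rw [neg_neg] at a b
  exact ⟨n, a, b⟩

variable {α β : ℝ}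

/-- With t = α/3 and c = 9, the four theta values are those of the two quotients for 1-2G, at α and
at β. -/
theorem cubicG_neg_exp_reciprocity (hα : 0 < α) (hβ : 0 < β) (h : α * β = π ^ 2) :
    (1 - 2 * cubicG (-exp (-α))) * (1 - 2 * cubicG (-exp (-β))) = 3 := by
  obtain ⟨-, a, -⟩ := cubicG_neg_exp hα
  obtain ⟨-, b, -⟩ := cubicG_neg_exp hβ
  have r := ramTheta_exp_reciprocity (t := α / 3) (c := 9) (by positivity) (by norm_num)
  rw [show 9 * (α / 3) = 3 * α by ring, ← h, show α * β / (3 * α) = β / 3 by field_simp,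
    show α * β / (α / 3) = 3 * β by field_simp,
    show √9 = 3 by rw [show (9 : ℝ) = 3 ^ 2 by norm_num, Real.sqrt_sq (by norm_num)],
    ← a, ← b] at r
  have n1 := ramTheta_exp_ne_zero (t := 3 * α) (by positivity)
  have n2 := ramTheta_exp_ne_zero (t := 3 * β) (by positivity)
  apply mul_right_cancel₀ (mul_ne_zero n1 n2)
  linear_combination r

/-- Here t = α and c = 3; the quotients for 1-8G³ are fourth powers, so the constant is (√3)⁴ = 9.
-/
theorem cubicG_neg_exp_cube_reciprocity (hα : 0 < α) (hβ : 0 < β) (h : α * β = π ^ 2 / 3) :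
    (1 - 8 * cubicG (-exp (-α)) ^ 3) * (1 - 8 * cubicG (-exp (-β)) ^ 3) = 9 := by
  obtain ⟨-, -, a⟩ := cubicG_neg_exp hα
  obtain ⟨-, -, b⟩ := cubicG_neg_exp hβ
  have r := ramTheta_exp_reciprocity (t := α) (c := 3) hα (by norm_num)
  have hp : π ^ 2 = 3 * (α * β) := by linarith
  rw [hp, show 3 * (α * β) / (3 * α) = β by field_simp,
    show 3 * (α * β) / α = 3 * β by field_simp] at r
  have r4 := congrArg (· ^ 4) r
  simp only [mul_pow] at r4
  rw [← a, ← b, show √3 ^ 4 = (√3 ^ 2) ^ 2 by ring, Real.sq_sqrt (by norm_num)] at r4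
  have n1 := ramTheta_exp_ne_zero (t := 3 * α) (by positivity)
  have n2 := ramTheta_exp_ne_zero (t := 3 * β) (by positivity)
  apply mul_right_cancel₀ (mul_ne_zero (pow_ne_zero 4 n1) (pow_ne_zero 4 n2))
  linear_combination r4

/-- The transformation exchanges φ(-·) and ψ, so α enters through 1-2G and β through 1+1/G, with
denominators cleared. -/
theorem cubicG_exp_reciprocity (hα : 0 < α) (hβ : 0 < β) (h : α * β = 2 * π ^ 2) :
    (1 - 2 * cubicG (exp (-α))) * (1 + cubicG (exp (-β))) = 3 * cubicG (exp (-β)) := by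
  obtain ⟨a, -, -, -⟩ := cubicG_exp hα
  obtain ⟨-, -, b, -⟩ := cubicG_exp hβ
  have r := ramTheta_neg_exp_reciprocity (t := α / 3) (c := 9) (by positivity) (by norm_num)
  have hp : π ^ 2 = α * β / 2 := by linarith
  rw [show 9 * (α / 3) = 3 * α by ring, hp,
    show α * β / 2 / (4 * (3 * α)) = β / 24 by field_simp; norm_num,
    -- The common e^{-β/24} cancels; the leftover e^{-β/3} is the factor x in `one_add_cubicG`.
    show α * β / 2 / (4 * (α / 3)) = β / 24 + β / 3 by field_simp; norm_num,
    show 2 * (α * β / 2) / (3 * α) = β / 3 by field_simp,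
    show 2 * (α * β / 2) / (α / 3) = 3 * β by field_simp, neg_add, exp_add,
    show √9 = 3 by rw [show (9 : ℝ) = 3 ^ 2 by norm_num, Real.sqrt_sq (by norm_num)],
    ← a] at r
  have n1 := ramTheta_neg_exp_ne_zero (t := 3 * α) (by positivity)
  have n2 := ramTheta_one_exp_ne_zero (t := β / 3) (by positivity)
  apply mul_right_cancel₀ (mul_ne_zero (mul_ne_zero n1 (exp_ne_zero (-(β / 24)))) n2)
  linear_combination (1 + cubicG (exp (-β))) * r +
    3 * ramTheta (-exp (-(3 * α))) (-exp (-(3 * α))) * exp (-(β / 24)) * b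

theorem cubicG_exp_cube_reciprocity (hα : 0 < α) (hβ : 0 < β) (h : α * β = 2 * π ^ 2 / 3) :
    (1 - 8 * cubicG (exp (-α)) ^ 3) * (1 + cubicG (exp (-β)) ^ 3) =
      9 * cubicG (exp (-β)) ^ 3 := by
  obtain ⟨-, a, -, -⟩ := cubicG_exp hα
  obtain ⟨-, -, -, b⟩ := cubicG_exp hβ
  have r := ramTheta_neg_exp_reciprocity (t := α) (c := 3) hα (by norm_num)
  have hp : π ^ 2 = 3 * (α * β) / 2 := by linarith
  rw [hp, show 3 * (α * β) / 2 / (4 * (3 * α)) = β / 8 by field_simp; norm_num,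
    -- The common e^{-β/8} cancels; the fourth power of the leftover e^{-β/4} is the x³ = e^{-β} of
    -- `one_add_cubicG_cube`.
    show 3 * (α * β) / 2 / (4 * α) = β / 8 + β / 4 by field_simp; norm_num,
    show 2 * (3 * (α * β) / 2) / (3 * α) = β by field_simp,
    show 2 * (3 * (α * β) / 2) / α = 3 * β by field_simp, neg_add, exp_add] at r
  have r4 := congrArg (· ^ 4) r
  simp only [mul_pow] at r4
  have e : exp (-(β / 4)) ^ 4 = exp (-β) := by
    rw [← exp_nat_mul]; congr 1; push_cast; ring
  rw [← a, e, show √3 ^ 4 = (√3 ^ 2) ^ 2 by ring, Real.sq_sqrt (by norm_num)] at r4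
  have n1 := ramTheta_neg_exp_ne_zero (t := 3 * α) (by positivity)
  have n2 := ramTheta_one_exp_ne_zero hβ
  apply mul_right_cancel₀ (mul_ne_zero (mul_ne_zero (pow_ne_zero 4 n1)
    (pow_ne_zero 4 (exp_ne_zero (-(β / 8))))) (pow_ne_zero 4 n2))
  linear_combination (1 + cubicG (exp (-β)) ^ 3) * r4 +
    9 * ramTheta (-exp (-(3 * α))) (-exp (-(3 * α))) ^ 4 * exp (-(β / 8)) ^ 4 * b

end Reciprocity

theorem mainTheorem3 :
    -- the continued fraction converges for `|q| < 1`, and it has the product formula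
    (∀ q : ℝ, |q| < 1 →
      Tendsto (fun n : ℕ => (cubicContFract q).convs n) atTop (𝓝 (cubicG q)) ∧
      Multipliable (cubicFactor q) ∧
      cubicG q = cubeRoot q * ∏' j : ℕ, cubicFactor q j) ∧
    -- the two forms of the relation are equivalent
    (∀ (k : ℤ) (x₁ x₂ : ℝ), x₁ + x₂ ≠ 0 →
      (((2 : ℝ) ^ k - x₁ * x₂) / (x₁ + x₂) = 1 ↔ (1 + x₁) * (1 + x₂) = 1 + (2 : ℝ) ^ k)) ∧
    -- the four reciprocity formulas
    (∀ α β : ℝ, 0 < α → 0 < β →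
      (α * β = Real.pi ^ 2 →
        cubicG (-Real.exp (-α)) ≠ 0 ∧ cubicG (-Real.exp (-β)) ≠ 0 ∧
        CubicReciprocity 1 (1 / cubicG (-Real.exp (-α))) (1 / cubicG (-Real.exp (-β)))) ∧
      (α * β = 2 * Real.pi ^ 2 →
        CubicReciprocity (-1) (cubicG (Real.exp (-α))) (cubicG (Real.exp (-β)))) ∧
      (α * β = Real.pi ^ 2 / 3 →
        cubicG (-Real.exp (-α)) ≠ 0 ∧ cubicG (-Real.exp (-β)) ≠ 0 ∧
        CubicReciprocity 3 (1 / cubicG (-Real.exp (-α)) ^ 3)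
          (1 / cubicG (-Real.exp (-β)) ^ 3)) ∧
      (α * β = 2 * Real.pi ^ 2 / 3 →
        CubicReciprocity (-3) (cubicG (Real.exp (-α)) ^ 3) (cubicG (Real.exp (-β)) ^ 3))) := by
  refine ⟨fun q hq => ⟨tendsto_cubicG hq, (hasProd_cubicFactor hq).multipliable,
    cubicG_eq_tprod hq⟩, fun k x₁ x₂ h => reciprocity_iff k h, fun α β hα hβ =>
    ⟨fun h => ?_, fun h => ?_, fun h => ?_, fun h => ?_⟩⟩
  · have ha := (cubicG_neg_exp hα).1
    have hb := (cubicG_neg_exp hβ).1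
    refine ⟨ha, hb, cubicReciprocity_of_mul ?_⟩
    have key := cubicG_neg_exp_reciprocity hα hβ h
    field_simp
    norm_num
    linear_combination -key / 2
  · have key := cubicG_exp_reciprocity hα hβ h
    refine cubicReciprocity_of_mul ?_
    norm_num
    linear_combination -key / 2
  · have ha := (cubicG_neg_exp hα).1
    have hb := (cubicG_neg_exp hβ).1
    refine ⟨ha, hb, cubicReciprocity_of_mul ?_⟩
    have key := cubicG_neg_exp_cube_reciprocity hα hβ h
    field_simp
    norm_num
    linear_combination -key / 8
  · have key := cubicG_exp_cube_reciprocity hα hβ h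
    refine cubicReciprocity_of_mul ?_
    norm_num
    linear_combination -key / 8
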